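/- Let $\mathcal G$ be a finite directed acyclic graph with vertex set $V$, and write $\mathrm{pa}(v)$ for the set of parents of $v$. Let every vertex $v$ carry a state in an open set $U_v\subset\mathbb R^{n_v}$. Let $\Phi_v:\prod_{z\in \mathrm{pa}(v)}U_z\to U_v$ (for $\mathrm{pa}(v)\neq\emptyset$) and $l_v:\prod_{z\in\{v\}\cup \mathrm{pa}(v)}U_z\to\mathbb R$ be of class $C^2$. Consider the constrained problem of minimizing $f(x)=\sum_{v} l_v(x_{\{v\}\cup \mathrm{pa}(v)})$ over $x\in\prod_v U_v$ subject to $h_v(x):=\Phi_v(x_{\mathrm{pa}(v)})-x_v=0$ for all $v$ with $\mathrm{pa}(v)\ne\emptyset$. Let $\mathcal L(x,\lambda)=f(x)+\sum_{\mathrm{pa}(v)\neq\emptyset}\lambda_v^{\mathsf T}h_v(x)$ be its Lagrangian. Its KKT system at a (not necessarily feasible) point $x\in\prod_v U_v$ and multipliers $\lambda$ is the linear system $$\begin{bmatrix}\partial_x^2\mathcal L(x,\lambda) & \partial_x h(x)^{\mathsf T}\\ \partial_x h(x) & 0\end{bmatrix}\begin{bmatrix}\delta x\\ \lambda^+\end{bmatrix}=\begin{bmatrix}-\partial_x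 f(x)\\ -h(x)\end{bmatrix}.$$ Let $(\mathcal T,\chi)$ be a tree decomposition of the hypergraph on $V$ with hyperedges $\{v\}\cup \mathrm{pa}(v)$, $v\in V$: a finite tree $\mathcal T$ with bags $\chi(i)\subset V$ that cover $V$, such that every hyperedge lies in some bag and, for every $v \in V$, the nodes $i$ with $v\in\chi(i)$ induce a non-empty subtree. Let $m$ be its size (the number of nodes of $\mathcal T$), $\mathrm{tw}=\max_i|\chi(i)|-1$ its width, $W=\max_i\sum_{v\in\chi(i)}n_v$ the largest number of scalar coordinates in a bag, and $n_{\max}=\max_v n_v$. Then the KKT system can be solved in $O(m\,W^3)$ arithmetic operations, and hence in $O\big(m\,(n_{\max}(\mathrm{tw}+1))^3\big)$, which is $O(m\,(\mathrm{tw}+1)^3)$ for scalar states. Precisely, there is a universal constant $C$ such that for all $\mathcal G$, $(n_v)$ and $(\mathcal T,\chi)$ there is an algebraic computation tree, depending on these only, which makes at most $C\,m\,W^3$ (and at most $C\,m\,(n_{\max}(\mathrm{tw}+1))^3$) additions, subtractions, multiplications, divisions and tests for zero on every path, and which, for all $l_v,\Phi_v,U_v,x,\lambda$ as above, given the entries of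 the matrix and of the right-hand side of the KKT system, never divides by zero and outputs a solution $(\delta x,\lambda^+)$, whenever the system has a solution (in particular whenever its matrix is nonsingular). -/

import Mathlib

/-! ### Computational graphs -/

section Graph

variable {V : Type*}

/-- A directed graph is acyclic if no vertex can be reached from itself by a directed path with at
least one edge. -/
def IsDAG (G : Digraph V) : Prop :=
  ∀ v, ¬ Relation.TransGen G.Adj v v

variable [Fintype V]

open scoped Classical in
/-- The parents of `v`. -/
noncomputable def parents (G : Digraph V) (v : V) : Finset V :=
  Finset.univ.filter fun u => G.Adj u v

/-- The set consisting of `v` and its parents. -/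
noncomputable def closedParents [DecidableEq V] (G : Digraph V) (v : V) : Finset V :=
  insert v (parents G v)

/-- The vertices that are not inputs; the inputs are the vertices without parents. -/
abbrev NonInput (G : Digraph V) : Type _ :=
  {v : V // (parents G v).Nonempty}

/-- The hyperedges of a computational graph: every vertex together with its parents. -/
def hyperedges [DecidableEq V] (G : Digraph V) : Set (Finset V) :=
  Set.range (closedParents G)

end Graph

/-! ### Tree decompositions of hypergraphs -/

/-- A tree decomposition, with tree nodes `I`, of the hypergraph on the vertex set `V` with the
given set of hyperedges. -/
structure TreeDecomposition {V : Type*} (edges : Set (Finset V)) (I : Type*) where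
  /-- the tree -/
  tree : SimpleGraph I
  isTree : tree.IsTree
  /-- the set of vertices attached to a node of the tree -/
  bag : I → Finset V
  vertex_cover : ∀ v, ∃ i, v ∈ bag i
  edge_cover : ∀ e ∈ edges, ∃ i, e ⊆ bag i
  /-- the nodes whose bags contain `v` induce a non-empty subtree -/
  subtree : ∀ v, (tree.induce {i | v ∈ bag i}).IsTree

namespace TreeDecomposition

variable {V I : Type*} [Fintype I] {edges : Set (Finset V)}

/-- The size of a tree decomposition: the number of nodes of its tree. -/
def size (_D : TreeDecomposition edges I) : ℕ :=
  Fintype.card I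

/-- The width of a tree decomposition: the largest cardinality of a bag, minus one. -/
def width (D : TreeDecomposition edges I) : ℕ :=
  (Finset.univ.sup fun i => (D.bag i).card) - 1

/-- The largest number of scalar coordinates in a bag, when the vertex `v` carries `n v` of them.
If all `n v` are `1` (and `V` is not empty) this is the width plus one. -/
def scalarBagSize (D : TreeDecomposition edges I) (n : V → ℕ) : ℕ :=
  Finset.univ.sup fun i => ∑ v ∈ D.bag i, n v

end TreeDecomposition

/-! ### The constrained problem and its KKT system -/

/-- A joint state of all vertices, the vertex `v` having a state in `ℝ^(n v)`. -/
abbrev State {V : Type*} (n : V → ℕ) : Type _ :=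
  ∀ v : V, Fin (n v) → ℝ

/-- An objective with the computational graph `G`: open state domains `dom v`, maps `Φ v` that
express the state of a non-input vertex through the states of its parents, and local objectives
`l v` depending on the states of `v` and its parents, all of class `C²`. The functions are total
functions of the states, but only their values on the domains matter; `Φ v` plays no role when `v`
is an input. -/
structure ComputationalStructure {V : Type*} [Fintype V] [DecidableEq V]
    (G : Digraph V) (n : V → ℕ) where
  dom : ∀ v, Set (Fin (n v) → ℝ)
  isOpen_dom : ∀ v, IsOpen (dom v)
  Φ : ∀ v, (∀ z : ↥(parents G v), Fin (n z) → ℝ) → (Fin (n v) → ℝ)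
  l : ∀ v, (∀ z : ↥(closedParents G v), Fin (n z) → ℝ) → ℝ
  mapsTo_Φ : ∀ v : NonInput G,
    Set.MapsTo (Φ v) (Set.univ.pi fun z : ↥(parents G v) => dom z) (dom v)
  contDiffOn_Φ : ∀ v : NonInput G,
    ContDiffOn ℝ 2 (Φ v) (Set.univ.pi fun z : ↥(parents G v) => dom z)
  contDiffOn_l : ∀ v,
    ContDiffOn ℝ 2 (l v) (Set.univ.pi fun z : ↥(closedParents G v) => dom z)

/-- Indices of the scalar primal variables. -/
abbrev PrimalIndex {V : Type*} (n : V → ℕ) : Type _ :=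
  Σ v : V, Fin (n v)

/-- Indices of the scalar multipliers: there is one for each coordinate of each non-input. -/
abbrev DualIndex {V : Type*} [Fintype V] (G : Digraph V) (n : V → ℕ) : Type _ :=
  Σ v : NonInput G, Fin (n v)

/-- Indices of the unknowns, and of the equations, of the KKT system. -/
abbrev KKTIndex {V : Type*} [Fintype V] (G : Digraph V) (n : V → ℕ) : Type _ :=
  PrimalIndex n ⊕ DualIndex G n

namespace ComputationalStructure

variable {V : Type*} [Fintype V] [DecidableEq V] {G : Digraph V} {n : V → ℕ}

/-- The unit vector of the joint state space in the direction of one scalar coordinate. -/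
def unitVector (a : PrimalIndex n) : State n :=
  Pi.single a.1 (Pi.single a.2 1)

/-- The objective of the constrained problem, as a function of the states of all vertices. -/
def objective (S : ComputationalStructure G n) (x : State n) : ℝ :=
  ∑ v, S.l v fun z => x z

/-- The constraint function `Φ_v - v` of a non-input vertex. -/
def constraint (S : ComputationalStructure G n) (v : NonInput G) (x : State n) :
    Fin (n v) → ℝ :=
  (S.Φ v fun z => x z) - x v

/-- The Lagrangian of the constrained problem. -/
noncomputable def lagrangian (S : ComputationalStructure G n)
    (lam : ∀ v : NonInput G, Fin (n v) → ℝ) (x : State n) : ℝ :=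
  S.objective x + ∑ v : NonInput G, lam v ⬝ᵥ S.constraint v x

/-- The Hessian, with respect to all the states, of the Lagrangian. -/
noncomputable def lagrangianHessian (S : ComputationalStructure G n)
    (lam : ∀ v : NonInput G, Fin (n v) → ℝ) (x : State n) :
    Matrix (PrimalIndex n) (PrimalIndex n) ℝ :=
  Matrix.of fun a b =>
    fderiv ℝ (fderiv ℝ (S.lagrangian lam)) x (unitVector a) (unitVector b)

/-- The Jacobian, with respect to all the states, of the constraints. -/
noncomputable def constraintJacobian (S : ComputationalStructure G n) (x : State n) :
    Matrix (DualIndex G n) (PrimalIndex n) ℝ :=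
  Matrix.of fun c b => fderiv ℝ (S.constraint c.1) x (unitVector b) c.2

/-- The KKT matrix at the nominal states `x` and multipliers `lam`. -/
noncomputable def kktMatrix (S : ComputationalStructure G n)
    (lam : ∀ v : NonInput G, Fin (n v) → ℝ) (x : State n) :
    Matrix (KKTIndex G n) (KKTIndex G n) ℝ :=
  Matrix.fromBlocks (S.lagrangianHessian lam x) (S.constraintJacobian x).transpose
    (S.constraintJacobian x) 0

/-- The right-hand side of the KKT system. -/
noncomputable def kktRHS (S : ComputationalStructure G n) (x : State n) : KKTIndex G n → ℝ :=
  Sum.elim (fun a => -fderiv ℝ S.objective x (unitVector a)) (fun c => -S.constraint c.1 x c.2)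

end ComputationalStructure

/-! ### Algebraic computation trees: exact real arithmetic with a count of operations -/

/-- The arithmetic operations. -/
inductive ArithOp where
  | add
  | sub
  | mul
  | div

/-- The value of an arithmetic operation; a division by zero is a failure. -/
noncomputable def ArithOp.eval : ArithOp → ℝ → ℝ → Option ℝ
  | .add, a, b => some (a + b)
  | .sub, a, b => some (a - b)
  | .mul, a, b => some (a * b)
  | .div, a, b => if b = 0 then none else some (a / b)

/-- Operands: one of the input numbers, the content of a register, or a rational constant. -/
inductive Operand (ι : Type*) where
  | input (i : ι)
  | reg (r : ℕ)
  | const (q : ℚ)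

/-- The value of an operand, given the input numbers and the contents of the registers. -/
noncomputable def Operand.eval {ι : Type*} (x : ι → ℝ) (mem : ℕ → ℝ) : Operand ι → ℝ
  | .input i => x i
  | .reg r => mem r
  | .const q => (q : ℝ)

/-- Algebraic computation trees, with real inputs indexed by `ι` and real outputs indexed by `κ`.
A tree either stops and outputs operands, or performs one arithmetic operation on two operands,
stores the value in a register, and goes on, or branches according to whether an operand is zero. -/
inductive ComputationTree (ι κ : Type*) where
  | output (res : κ → Operand ι)
  | arith (op : ArithOp) (a b : Operand ι) (dst : ℕ) (next : ComputationTree ι κ)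
  | branch (a : Operand ι) (ifZero ifNonzero : ComputationTree ι κ)

namespace ComputationTree

variable {ι κ : Type*}

/-- The output of a computation tree on the input `x`, starting with register contents `mem`;
there is none if a division by zero is attempted. -/
noncomputable def run (x : ι → ℝ) : ComputationTree ι κ → (ℕ → ℝ) → Option (κ → ℝ)
  | .output res, mem => some fun k => (res k).eval x mem
  | .arith op a b dst next, mem =>
      (op.eval (a.eval x mem) (b.eval x mem)).bind fun y => run x next (Function.update mem dst y)
  | .branch a t f, mem =>
      open scoped Classical in if a.eval x mem = 0 then run x t mem else run x f mem

/-- The output of a computation tree on the input `x`, all registers being zero at the start. -/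
noncomputable def result (T : ComputationTree ι κ) (x : ι → ℝ) : Option (κ → ℝ) :=
  T.run x 0

/-- The cost of a computation tree: the largest number of arithmetic operations and zero tests on
a path from the root to an output. -/
def cost : ComputationTree ι κ → ℕ
  | .output _ => 0
  | .arith _ _ _ _ next => next.cost + 1
  | .branch _ t f => max t.cost f.cost + 1

end ComputationTree

/-- A computation tree whose input is a matrix and a right-hand side, all with index set `κ`, and
whose output is a vector with index set `κ`. -/
abbrev LinearSolver (κ : Type*) : Type _ :=
  ComputationTree ((κ × κ) ⊕ κ) κ

/-- The output of a linear solver on the linear system `A z = r`. -/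
noncomputable def LinearSolver.solve {κ : Type*} (T : LinearSolver κ) (A : Matrix κ κ ℝ)
    (r : κ → ℝ) : Option (κ → ℝ) :=
  T.result (Sum.elim (fun p => A p.1 p.2) r)

/-! Every summand of the Lagrangian, and every constraint, depends only on the states of one
hyperedge. If the multiplier of `v` is regarded as a further unknown at `v`, a nonzero entry of the
KKT matrix therefore couples two unknowns whose vertices lie in a common hyperedge
(`exists_of_kktMatrix_ne_zero`), hence in a common bag. What remains is to solve a consistent system
`A z = r` whose sparsity pattern is given by the bags of a tree.

The matrix may be singular or have singular blocks, so Schur complements along the tree need not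
exist. Instead, each nonzero entry of `A` and each entry of `r` is assigned to one node whose bag
contains its indices, and the flow `u i a` is the share of node `i` in the residual of row `a`. Then
`A z = r` says that the flows sum to zero in every component, while each node carries a linear
relation between the states and flows on its own bag (`treeSolution_nodeEquation_iff`).

Such a system is solved by removing leaves (`SimpleGraph.IsTree.eliminationOrder`). A component in
the bag of the leaf `j` but not in that of its neighbour `p` occurs in no other bag. The relations
at `j` and `p` can thus be merged into one relation at `p`, with `u p + u j` as its flow, by
projecting out all other local unknowns. Gaussian elimination with a search for pivots does this for
any ranks, and consistency allows the result to be cut down to at most `2 * (B p).card` equations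
(`project`). This bound is the invariant that keeps the cost of each node cubic; back substitution
then recovers the eliminated values (`solve_tree`).

Operations are counted with `Comp`, where a stage of a computation is the set of functions of the
input evaluated so far, together with a set containing the inputs that reach it. Registers appear
only in the translation `Comp.exists_computationTree`. -/

/-! ### Computations seen through the functions of the input that they have evaluated -/

/-- `Comp Goal c X K` says that a computation which knows the values of the functions in `K` of its
input, and that the input lies in `X`, can reach by at most `c` arithmetic operations and zero tests
on every path a set `X'` of inputs and a set `K'` of known functions that satisfy `Goal X' K'`. -/
inductive Comp {Ω : Type*} (Goal : Set Ω → Set (Ω → ℝ) → Prop) :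
    ℕ → Set Ω → Set (Ω → ℝ) → Prop
  | done {c : ℕ} {X : Set Ω} {K : Set (Ω → ℝ)} (h : Goal X K) : Comp Goal c X K
  | arith {c : ℕ} {X : Set Ω} {K : Set (Ω → ℝ)} (op : ArithOp) {f g h : Ω → ℝ} (hf : f ∈ K)
      (hg : g ∈ K) (hop : ∀ ω ∈ X, op.eval (f ω) (g ω) = some (h ω))
      (next : Comp Goal c X (insert h K)) : Comp Goal (c + 1) X K
  | test {c : ℕ} {X : Set Ω} {K : Set (Ω → ℝ)} {f : Ω → ℝ} (hf : f ∈ K)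
      (ifZero : Comp Goal c (X ∩ {ω | f ω = 0}) K)
      (ifNonzero : Comp Goal c (X ∩ {ω | f ω ≠ 0}) K) : Comp Goal (c + 1) X K

namespace Comp

variable {Ω : Type*} {Goal Goal' : Set Ω → Set (Ω → ℝ) → Prop} {c c' : ℕ} {X : Set Ω}
  {K : Set (Ω → ℝ)}

theorem mono_cost (h : Comp Goal c X K) (hc : c ≤ c') : Comp Goal c' X K := by
  induction h generalizing c' with
  | done h => exact .done h
  | arith op hf hg hop _ ih =>
    obtain ⟨d, rfl⟩ := Nat.exists_eq_add_of_le' hc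
    rw [← add_assoc]
    exact .arith op hf hg hop (ih (Nat.le_add_left _ _))
  | test hf _ _ ih₁ ih₂ =>
    obtain ⟨d, rfl⟩ := Nat.exists_eq_add_of_le' hc
    rw [← add_assoc]
    exact .test hf (ih₁ (Nat.le_add_left _ _)) (ih₂ (Nat.le_add_left _ _))

/-- Sequential composition. -/
theorem bind (h : Comp Goal c X K)
    (h' : ∀ X' K', X' ⊆ X → K ⊆ K' → Goal X' K' → Comp Goal' c' X' K') :
    Comp Goal' (c + c') X K := by
  induction h with
  | done h => exact (h' _ _ subset_rfl subset_rfl h).mono_cost (by omega)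
  | arith op hf hg hop _ ih =>
    rw [add_right_comm]
    exact .arith op hf hg hop
      (ih fun X' K' hX hK => h' X' K' hX ((Set.subset_insert _ _).trans hK))
  | test hf _ _ ih₁ ih₂ =>
    rw [add_right_comm]
    exact .test hf (ih₁ fun X' K' hX => h' X' K' (hX.trans Set.inter_subset_left))
      (ih₂ fun X' K' hX => h' X' K' (hX.trans Set.inter_subset_left))

theorem weaken (h : Comp Goal c X K)
    (h' : ∀ X' K', X' ⊆ X → K ⊆ K' → Goal X' K' → Goal' X' K') : Comp Goal' c X K :=
  h.bind (c' := 0) fun X' K' hX hK hG => .done (h' X' K' hX hK hG)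

theorem arith_mem (op : ArithOp) {f g h : Ω → ℝ} (hf : f ∈ K) (hg : g ∈ K)
    (hop : ∀ ω ∈ X, op.eval (f ω) (g ω) = some (h ω)) : Comp (fun _ K' => h ∈ K') 1 X K :=
  .arith op hf hg hop (.done (c := 0) (Set.mem_insert _ _))

theorem sub {f g : Ω → ℝ} (hf : f ∈ K) (hg : g ∈ K) :
    Comp (fun _ K' => (fun ω => f ω - g ω) ∈ K') 1 X K :=
  arith_mem .sub hf hg fun _ _ => rfl

theorem mul {f g : Ω → ℝ} (hf : f ∈ K) (hg : g ∈ K) :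
    Comp (fun _ K' => (fun ω => f ω * g ω) ∈ K') 1 X K :=
  arith_mem .mul hf hg fun _ _ => rfl

theorem div {f g : Ω → ℝ} (hf : f ∈ K) (hg : g ∈ K) (h0 : ∀ ω ∈ X, g ω ≠ 0) :
    Comp (fun _ K' => (fun ω => f ω / g ω) ∈ K') 1 X K :=
  arith_mem .div hf hg fun ω hω => by simp [ArithOp.eval, h0 ω hω]

/-- Computing a family of functions, one after the other. -/
theorem forall_mem_list {α : Type*} (h : α → Ω → ℝ) (l : List α)
    (hl : ∀ k ∈ l, ∀ K', K ⊆ K' → ∀ X' ⊆ X, Comp (fun _ K'' => h k ∈ K'') c X' K') :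
    Comp (fun _ K' => ∀ k ∈ l, h k ∈ K') (l.length * c) X K := by
  induction l generalizing X K with
  | nil => exact .done (by simp)
  | cons a l ih =>
    rw [List.length_cons, Nat.succ_mul, add_comm]
    refine (hl a (by simp) K subset_rfl X subset_rfl).bind fun X' K' hX hK ha => ?_
    refine (ih fun k hk K₁ hK₁ X₁ hX₁ => hl k (by simp [hk]) K₁ (hK.trans hK₁) X₁
      (hX₁.trans hX)).weaken fun X'' K'' _ hK' hall => ?_
    simpa using ⟨hK' ha, hall⟩

theorem forall_mem_finset {α : Type*} (h : α → Ω → ℝ) (s : Finset α)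
    (hs : ∀ k ∈ s, ∀ K', K ⊆ K' → ∀ X' ⊆ X, Comp (fun _ K'' => h k ∈ K'') c X' K') :
    Comp (fun _ K' => ∀ k ∈ s, h k ∈ K') (s.card * c) X K := by
  simpa using forall_mem_list h s.toList (by simpa using hs)

theorem sub_sum_mul {α : Type*} {f : Ω → ℝ} {g h : α → Ω → ℝ} {s : Finset α} (hf : f ∈ K)
    (hg : ∀ k ∈ s, g k ∈ K) (hh : ∀ k ∈ s, h k ∈ K) :
    Comp (fun _ K' => (fun ω => f ω - ∑ k ∈ s, g k ω * h k ω) ∈ K') (2 * s.card) X K := by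
  classical
  induction s using Finset.induction_on generalizing X K f with
  | empty => exact .done (by simpa using hf)
  | insert a s ha ih =>
    rw [Finset.card_insert_of_notMem ha, show 2 * (s.card + 1) = 1 + (1 + 2 * s.card) by ring]
    refine (mul (hg a (by simp)) (hh a (by simp))).bind fun X₁ K₁ _ hK₁ h₁ => ?_
    refine (sub (hK₁ hf) h₁).bind fun X₂ K₂ _ hK₂ h₂ => ?_
    refine (ih h₂ (fun k hk => hK₂ (hK₁ (hg k (by simp [hk]))))
      fun k hk => hK₂ (hK₁ (hh k (by simp [hk])))).weaken fun _ _ _ _ h => ?_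
    simpa only [Finset.sum_insert ha, sub_sub] using h

end Comp

/-! ### From computations to computation trees -/

/-- All registers that the operand refers to lie below `N`. -/
def Operand.Below {ι : Type*} (N : ℕ) : Operand ι → Prop
  | .reg r => r < N
  | _ => True

theorem Operand.Below.mono {ι : Type*} {N M : ℕ} {o : Operand ι} (h : o.Below N) (hNM : N ≤ M) :
    o.Below M := by
  cases o with
  | reg r => exact lt_of_lt_of_le h hNM
  | _ => trivial

theorem Operand.Below.eval_update {ι : Type*} {N : ℕ} {o : Operand ι} (h : o.Below N) (x : ι → ℝ)
    (mem : ℕ → ℝ) (y : ℝ) : o.eval x (Function.update mem N y) = o.eval x mem := by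
  cases o with
  | reg r => exact Function.update_of_ne (ne_of_lt h) _ _
  | _ => rfl

/-- A computation that evaluates functions `z` with `P ω (z ω)` is carried out by a computation
tree of the same cost. -/
theorem Comp.exists_computationTree {ι κ Ω : Type*} {P : Ω → (κ → ℝ) → Prop} {c : ℕ} {X : Set Ω}
    {K : Set (Ω → ℝ)} (inp : Ω → ι → ℝ)
    (h : Comp (fun X K => ∃ z : κ → Ω → ℝ, (∀ k, z k ∈ K) ∧ ∀ ω ∈ X, P ω fun k => z k ω) c X K)
    (mem : Ω → ℕ → ℝ) (N : ℕ)
    (hK : ∀ f ∈ K, ∃ o : Operand ι, o.Below N ∧ ∀ ω ∈ X, o.eval (inp ω) (mem ω) = f ω) :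
    ∃ T : ComputationTree ι κ, T.cost ≤ c ∧
      ∀ ω ∈ X, ∃ z, T.run (inp ω) (mem ω) = some z ∧ P ω z := by
  induction h generalizing mem N with
  | done h =>
    obtain ⟨z, hz, hP⟩ := h
    choose o _ ho using fun k => hK _ (hz k)
    refine ⟨.output o, Nat.zero_le _, fun ω hω => ⟨_, rfl, ?_⟩⟩
    simpa only [ho _ ω hω] using hP ω hω
  | @arith c X K op f g h hf hg hop _ ih =>
    obtain ⟨a, haN, ha⟩ := hK f hf
    obtain ⟨b, hbN, hb⟩ := hK g hg
    -- The result goes to the fresh register `N`, so operands that refer to registers below `N` keep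
    -- their values.
    obtain ⟨T, hT, hrun⟩ := ih (fun ω => Function.update (mem ω) N (h ω)) (N + 1) (by
      rintro f' (rfl | hf')
      · exact ⟨.reg N, Nat.lt_succ_self N, fun ω _ => by simp [Operand.eval]⟩
      · obtain ⟨o, hoN, ho⟩ := hK f' hf'
        exact ⟨o, hoN.mono (Nat.le_succ N), fun ω hω => by rw [hoN.eval_update, ho ω hω]⟩)
    refine ⟨.arith op a b N T, Nat.succ_le_succ hT, fun ω hω => ?_⟩
    simpa only [ComputationTree.run, ha ω hω, hb ω hω, hop ω hω, Option.bind_some] using hrun ω hω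
  | @test c X K f hf _ _ ih₁ ih₂ =>
    obtain ⟨a, -, ha⟩ := hK f hf
    have restrict : ∀ Y ⊆ X, ∀ f ∈ K, ∃ o : Operand ι, o.Below N ∧
        ∀ ω ∈ Y, o.eval (inp ω) (mem ω) = f ω := fun Y hY f hf => by
      obtain ⟨o, hoN, ho⟩ := hK f hf
      exact ⟨o, hoN, fun ω hω => ho ω (hY hω)⟩
    obtain ⟨T₁, hT₁, h₁⟩ := ih₁ mem N (restrict _ Set.inter_subset_left)
    obtain ⟨T₂, hT₂, h₂⟩ := ih₂ mem N (restrict _ Set.inter_subset_left)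
    refine ⟨.branch a T₁ T₂, Nat.succ_le_succ (max_le hT₁ hT₂), fun ω hω => ?_⟩
    by_cases h0 : f ω = 0
    · simpa only [ComputationTree.run, ha ω hω, if_pos h0] using h₁ ω ⟨hω, h0⟩
    · simpa only [ComputationTree.run, ha ω hω, if_neg h0] using h₂ ω ⟨hω, h0⟩

/-! ### Gaussian elimination of systems of linear equations -/

/-- A linear equation in unknowns indexed by `γ`, whose coefficients and right-hand side are
functions of the input. -/
structure Row (γ Ω : Type*) where
  coef : γ → Ω → ℝ
  rhs : Ω → ℝ

namespace Row

variable {γ Ω : Type*}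

/-- `y` solves the equation in the unknowns in `V`. -/
def Sat (r : Row γ Ω) (V : Finset γ) (ω : Ω) (y : γ → ℝ) : Prop :=
  ∑ c ∈ V, r.coef c ω * y c = r.rhs ω

/-- The right-hand side and the coefficients at `V` lie in `K`. -/
def Known (r : Row γ Ω) (V : Finset γ) (K : Set (Ω → ℝ)) : Prop :=
  (∀ c ∈ V, r.coef c ∈ K) ∧ r.rhs ∈ K

/-- The difference of `r` and a multiple of `ρ`, chosen such that the unknown `b` is eliminated. -/
noncomputable def eliminate (r ρ : Row γ Ω) (b : γ) : Row γ Ω where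
  coef c ω := r.coef c ω - r.coef b ω / ρ.coef b ω * ρ.coef c ω
  rhs ω := r.rhs ω - r.coef b ω / ρ.coef b ω * ρ.rhs ω

open scoped Classical in
/-- The equation with the coefficients outside `V` replaced by zero. -/
noncomputable def restrict (r : Row γ Ω) (V : Finset γ) : Row γ Ω where
  coef c ω := if c ∈ V then r.coef c ω else 0
  rhs := r.rhs

theorem Known.mono {r : Row γ Ω} {V W : Finset γ} {K K' : Set (Ω → ℝ)} (h : r.Known V K)
    (hW : W ⊆ V) (hK : K ⊆ K') : r.Known W K' :=
  ⟨fun c hc => hK (h.1 c (hW hc)), hK h.2⟩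

theorem Known.restrict {r : Row γ Ω} {V : Finset γ} {K : Set (Ω → ℝ)} (h : r.Known V K)
    (h0 : (fun _ => 0) ∈ K) (W : Finset γ) : (r.restrict V).Known W K := by
  refine ⟨fun c _ => ?_, h.2⟩
  by_cases hc : c ∈ V
  · simpa [Row.restrict, hc] using h.1 c hc
  · simpa [Row.restrict, hc] using h0

/-- Setting coefficients to zero allows an equation in few unknowns to be listed among equations in
more unknowns. -/
theorem sat_restrict {r : Row γ Ω} {V W : Finset γ} (hVW : V ⊆ W) {ω : Ω} {y : γ → ℝ} :
    (r.restrict V).Sat W ω y ↔ r.Sat V ω y := by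
  classical
  have : ∑ c ∈ W, (r.restrict V).coef c ω * y c = ∑ c ∈ V, r.coef c ω * y c := by
    simp only [restrict, ite_mul, zero_mul, Finset.sum_ite_mem, Finset.inter_eq_right.2 hVW]
  rw [Sat, Sat, this]
  rfl

theorem sat_congr {r : Row γ Ω} {V : Finset γ} {ω : Ω} {y y' : γ → ℝ} (h : ∀ c ∈ V, y c = y' c) :
    r.Sat V ω y ↔ r.Sat V ω y' := by
  rw [Sat, Sat, Finset.sum_congr rfl fun c hc => by rw [h c hc]]

variable [DecidableEq γ]

theorem sat_insert {r : Row γ Ω} {V : Finset γ} {b : γ} (hb : b ∉ V) {ω : Ω} {y : γ → ℝ} :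
    r.Sat (insert b V) ω y ↔ r.coef b ω * y b + ∑ c ∈ V, r.coef c ω * y c = r.rhs ω := by
  rw [Sat, Finset.sum_insert hb]

theorem sat_insert_of_coef_eq_zero {r : Row γ Ω} {V : Finset γ} {b : γ} (hb : b ∉ V) {ω : Ω}
    {y : γ → ℝ} (h : r.coef b ω = 0) : r.Sat (insert b V) ω y ↔ r.Sat V ω y := by
  rw [sat_insert hb, h, zero_mul, zero_add, Sat]

/-- Subtracting a multiple of `ρ` is reversible only at points where `ρ` itself holds. -/
theorem sat_eliminate {r ρ : Row γ Ω} {V : Finset γ} {b : γ} (hb : b ∉ V) {ω : Ω} {y : γ → ℝ}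
    (h0 : ρ.coef b ω ≠ 0) (hρ : ρ.Sat (insert b V) ω y) :
    (r.eliminate ρ b).Sat V ω y ↔ r.Sat (insert b V) ω y := by
  rw [sat_insert hb] at hρ ⊢
  have : ∑ c ∈ V, (r.eliminate ρ b).coef c ω * y c
      = ∑ c ∈ V, r.coef c ω * y c
        - r.coef b ω / ρ.coef b ω * ∑ c ∈ V, ρ.coef c ω * y c := by
    rw [Finset.mul_sum, ← Finset.sum_sub_distrib]
    exact Finset.sum_congr rfl fun c _ => by simp only [eliminate]; ring
  rw [Sat, this, eq_sub_of_add_eq' hρ]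
  simp only [eliminate]
  have h : r.coef b ω / ρ.coef b ω * (ρ.rhs ω - ρ.coef b ω * y b)
      = r.coef b ω / ρ.coef b ω * ρ.rhs ω - r.coef b ω * y b := by
    field_simp
  rw [h]
  constructor <;> intro h' <;> linarith

/-- One division yields the multiplier; each coefficient at `V` and the right-hand side then take a
multiplication and a subtraction. -/
theorem comp_eliminate {r ρ : Row γ Ω} {V : Finset γ} {b : γ} {X : Set Ω} {K : Set (Ω → ℝ)}
    (hr : r.Known (insert b V) K) (hρ : ρ.Known (insert b V) K) (h0 : ∀ ω ∈ X, ρ.coef b ω ≠ 0) :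
    Comp (fun _ K' => (r.eliminate ρ b).Known V K') (2 * V.card + 3) X K := by
  have step : ∀ {X' : Set Ω} {K' : Set (Ω → ℝ)} {f g : Ω → ℝ},
      (fun ω => r.coef b ω / ρ.coef b ω) ∈ K' → f ∈ K' → g ∈ K' →
      Comp (fun _ K' => (fun ω => f ω - r.coef b ω / ρ.coef b ω * g ω) ∈ K') 2 X' K' :=
    fun hm hf hg => (Comp.mul hm hg).bind (c' := 1) fun _ _ _ hK h => Comp.sub (hK hf) h
  rw [show 2 * V.card + 3 = 1 + (V.card * 2 + 2) by ring]
  refine (Comp.div (hr.1 b (by simp)) (hρ.1 b (by simp)) h0).bind fun X₁ K₁ _ hK₁ hm => ?_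
  refine (Comp.forall_mem_finset (r.eliminate ρ b).coef V fun c hc K' hK' X' _ =>
    step (hK' hm) (hK' (hK₁ (hr.1 c (by simp [hc])))) (hK' (hK₁ (hρ.1 c (by simp [hc]))))).bind
    fun X₂ K₂ _ hK₂ hcoef => ?_
  exact (step (hK₂ hm) (hK₂ (hK₁ hr.2)) (hK₂ (hK₁ hρ.2))).weaken
    fun X₃ K₃ _ hK₃ h => ⟨fun c hc => hK₃ (hcoef c hc), h⟩

end Row

/-! ### Elimination of unknowns from whole systems, with its cost -/

namespace Comp

variable {γ Ω : Type*} {X : Set Ω} {K : Set (Ω → ℝ)} {L : List (Row γ Ω)}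

/-- The coefficients of `b` are tested in turn until one is nonzero. The branching makes the pivot
row the same for all inputs that follow one path. -/
theorem exists_pivot {V : Finset γ} {b : γ} (hb : b ∈ V) (hL : ∀ r ∈ L, r.Known V K) :
    Comp (fun X' _ => (∀ r ∈ L, ∀ ω ∈ X', r.coef b ω = 0) ∨
      ∃ ρ ∈ L, ∀ ω ∈ X', ρ.coef b ω ≠ 0) L.length X K := by
  induction L generalizing X with
  | nil => exact .done (by simp)
  | cons r L ih =>
    refine .test ((hL r (by simp)).1 b hb) ?_ (.done (.inr ⟨r, by simp, fun ω hω => hω.2⟩))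
    refine (ih fun r' hr' => hL r' (by simp [hr'])).weaken fun X' K' hX _ h => ?_
    rcases h with h | ⟨ρ, hρ, h⟩
    · refine .inl fun r' hr' ω hω => ?_
      rcases List.mem_cons.1 hr' with rfl | hr'
      · exact (hX hω).2
      · exact h r' hr' ω hω
    · exact .inr ⟨ρ, by simp [hρ], h⟩

variable [DecidableEq γ]

/-- Elimination of one unknown `b` from a list of equations. -/
theorem eliminate {V : Finset γ} {b : γ} (hb : b ∉ V) (hL : ∀ r ∈ L, r.Known (insert b V) K) :
    Comp (fun X' K' => ∃ L' : List (Row γ Ω), L'.length = L.length ∧ (∀ r ∈ L', r.Known V K') ∧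
      ((∀ ω ∈ X', ∀ y, (∀ r ∈ L, r.Sat (insert b V) ω y) ↔ ∀ r ∈ L', r.Sat V ω y) ∨
        ∃ ρ ∈ L, (∀ ω ∈ X', ρ.coef b ω ≠ 0) ∧ ∀ ω ∈ X', ∀ y,
          (∀ r ∈ L, r.Sat (insert b V) ω y) ↔
            ρ.Sat (insert b V) ω y ∧ ∀ r ∈ L', r.Sat V ω y))
      (L.length * (2 * V.card + 4)) X K := by
  rw [show L.length * (2 * V.card + 4) = L.length + L.length * (2 * V.card + 3) by ring]
  refine (exists_pivot (Finset.mem_insert_self b V) hL).bind fun X₁ K₁ hX₁ hK₁ h => ?_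
  rcases h with h | ⟨ρ, hρ, h0⟩
  · refine .done ⟨L, rfl, fun r hr => (hL r hr).mono (Finset.subset_insert _ _) hK₁, .inl ?_⟩
    intro ω hω y
    exact forall₂_congr fun r hr => Row.sat_insert_of_coef_eq_zero hb (h r hr ω hω)
  · have key : ∀ l : List (Row γ Ω), l ⊆ L → ∀ X' ⊆ X₁, ∀ K', K₁ ⊆ K' →
        Comp (fun _ K' => ∀ r ∈ l, (r.eliminate ρ b).Known V K') (l.length * (2 * V.card + 3))
          X' K' := by
      intro l
      induction l with
      | nil => exact fun _ _ _ _ _ => .done (by simp)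
      | cons r l ih =>
        intro hl X' hX' K' hK'
        rw [List.length_cons, Nat.succ_mul, add_comm]
        refine (Row.comp_eliminate ((hL r (hl (by simp))).mono subset_rfl (hK₁.trans hK'))
          ((hL ρ hρ).mono subset_rfl (hK₁.trans hK')) fun ω hω => h0 ω (hX' hω)).bind
          fun X₂ K₂ hX₂ hK₂ hr => ?_
        refine (ih (fun r' hr' => hl (by simp [hr'])) X₂ (hX₂.trans hX') K₂
          (hK'.trans hK₂)).weaken fun X₃ K₃ _ hK₃ hall => ?_
        simpa using ⟨hr.mono subset_rfl hK₃, hall⟩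
    -- The pivot row is also eliminated against itself. The resulting trivial equation is kept, so
    -- that the number of equations does not change.
    refine (key L (List.Subset.refl L) X₁ subset_rfl K₁ subset_rfl).weaken
      fun X₂ K₂ hX₂ hK₂ hall =>
        ⟨L.map fun r => r.eliminate ρ b, by simp, by simpa using hall, .inr
          ⟨ρ, hρ, fun ω hω => h0 ω (hX₂ hω), fun ω hω y => ?_⟩⟩
    rw [List.forall_mem_map]
    constructor
    · exact fun h => ⟨h ρ hρ, fun r hr =>
        (Row.sat_eliminate hb (h0 ω (hX₂ hω)) (h ρ hρ)).2 (h r hr)⟩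
    · exact fun h r hr => (Row.sat_eliminate hb (h0 ω (hX₂ hω)) h.1).1 (h.2 r hr)

/-- A consistent system is equivalent to one with at most as many equations as unknowns. -/
theorem reduce {V : Finset γ} (h0 : (fun _ => 0) ∈ K) (hL : ∀ r ∈ L, r.Known V K)
    (hsol : ∀ ω ∈ X, ∃ y, ∀ r ∈ L, r.Sat V ω y) :
    Comp (fun X' K' => ∃ L' : List (Row γ Ω), L'.length ≤ V.card ∧ (∀ r ∈ L', r.Known V K') ∧
      ∀ ω ∈ X', ∀ y, (∀ r ∈ L, r.Sat V ω y) ↔ ∀ r ∈ L', r.Sat V ω y)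
      (V.card * (L.length * (2 * V.card + 4))) X K := by
  induction V using Finset.induction_on generalizing X K L with
  | empty =>
    -- Without unknowns an equation holds for all `y` or for none. Consistency excludes the latter,
    -- so every equation can be dropped.
    refine .done ⟨[], by simp, by simp, fun ω hω y => ?_⟩
    obtain ⟨y', hy'⟩ := hsol ω hω
    simpa [Row.Sat] using hy'
  | insert b V hb ih =>
    have hcost : L.length * (2 * V.card + 4) + V.card * (L.length * (2 * V.card + 4)) ≤
        (insert b V).card * (L.length * (2 * (insert b V).card + 4)) := by
      rw [Finset.card_insert_of_notMem hb, add_comm (L.length * _), ← Nat.succ_mul]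
      gcongr
      omega
    refine Comp.mono_cost ?_ hcost
    refine (eliminate hb hL).bind fun X₁ K₁ hX₁ hK₁ h => ?_
    obtain ⟨L₁, hlen, hL₁, h⟩ := h
    rw [← hlen]
    have hsol₁ : ∀ ω ∈ X₁, ∃ y, ∀ r ∈ L₁, r.Sat V ω y := fun ω hω => by
      obtain ⟨y, hy⟩ := hsol ω (hX₁ hω)
      rcases h with h | ⟨ρ, hρ, -, h⟩
      · exact ⟨y, (h ω hω y).1 hy⟩
      · exact ⟨y, ((h ω hω y).1 hy).2⟩
    refine (ih (hK₁ h0) hL₁ hsol₁).weaken fun X₂ K₂ hX₂ hK₂ h₂ => ?_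
    obtain ⟨L₂, hlen₂, hL₂, h₂⟩ := h₂
    have hrestrict : ∀ ω y, (∀ r ∈ L₂.map fun r => r.restrict V, r.Sat (insert b V) ω y) ↔
        ∀ r ∈ L₂, r.Sat V ω y := fun ω y => by
      rw [List.forall_mem_map]
      exact forall₂_congr fun r _ => Row.sat_restrict (Finset.subset_insert b V)
    have hknown : ∀ r ∈ L₂.map fun r => r.restrict V, r.Known (insert b V) K₂ := by
      rw [List.forall_mem_map]
      exact fun r hr => (hL₂ r hr).restrict (hK₂ (hK₁ h0)) _
    rw [Finset.card_insert_of_notMem hb]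
    rcases h with h | ⟨ρ, hρ, -, h⟩
    · refine ⟨_, by simpa using hlen₂.trans (Nat.le_succ _), hknown, fun ω hω y => ?_⟩
      rw [hrestrict, h ω (hX₂ hω), h₂ ω hω]
    -- The pivot equation determines `b` from the other unknowns; it is the one equation added for
    -- the one unknown added.
    · refine ⟨ρ :: L₂.map fun r => r.restrict V, by simpa using hlen₂, ?_, fun ω hω y => ?_⟩
      · rw [List.forall_mem_cons]
        exact ⟨(hL ρ hρ).mono subset_rfl (hK₁.trans hK₂), hknown⟩
      · rw [List.forall_mem_cons, hrestrict, h ω (hX₂ hω), h₂ ω hω]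

/-- Back substitution: after elimination of the unknowns `V₁`, values of the other unknowns `V₂`
that satisfy the equations `L'` can be extended to a solution of the system `L` by at most `c`
operations. -/
def Extendable (L : List (Row γ Ω)) (V₁ V₂ : Finset γ) (L' : List (Row γ Ω)) (c : ℕ) (X : Set Ω)
    (K : Set (Ω → ℝ)) : Prop :=
  ∀ X' ⊆ X, ∀ K', K ⊆ K' → ∀ y : γ → Ω → ℝ, (∀ k ∈ V₂, y k ∈ K') →
    (∀ ω ∈ X', ∀ r ∈ L', r.Sat V₂ ω fun k => y k ω) →
    Comp (fun X'' K'' => ∃ y' : γ → Ω → ℝ, (∀ k ∈ V₁ ∪ V₂, y' k ∈ K'') ∧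
      (∀ k ∈ V₂, y' k = y k) ∧ ∀ ω ∈ X'', ∀ r ∈ L, r.Sat (V₁ ∪ V₂) ω fun k => y' k ω) c X' K'

/-- Elimination of several unknowns. -/
theorem eliminate_finset {V₁ V₂ : Finset γ} (hV : Disjoint V₁ V₂) (h0 : (fun _ => 0) ∈ K)
    (hL : ∀ r ∈ L, r.Known (V₁ ∪ V₂) K) :
    Comp (fun X' K' => ∃ L' : List (Row γ Ω), L'.length = L.length ∧ (∀ r ∈ L', r.Known V₂ K') ∧
      (∀ ω ∈ X', ∀ y, (∀ r ∈ L, r.Sat (V₁ ∪ V₂) ω y) → ∀ r ∈ L', r.Sat V₂ ω y) ∧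
      Extendable L V₁ V₂ L' (V₁.card * (2 * (V₁ ∪ V₂).card + 1)) X' K')
      (V₁.card * (L.length * (2 * (V₁ ∪ V₂).card + 4))) X K := by
  induction V₁ using Finset.induction_on generalizing X K L with
  | empty =>
    refine .done ⟨L, rfl, by simpa using hL, by simp, ?_⟩
    intro X' _ K' _ y hy hsat
    exact .done ⟨y, by simpa using hy, fun _ _ => rfl, by simpa using hsat⟩
  | insert b V₁ hb ih =>
    rw [Finset.disjoint_insert_left] at hV
    have hb' : b ∉ V₁ ∪ V₂ := by simp [hb, hV.1]
    simp only [Finset.insert_union, Finset.card_insert_of_notMem hb,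
      Finset.card_insert_of_notMem hb'] at hL ⊢
    set q := (V₁ ∪ V₂).card with hq
    have hcost : L.length * (2 * q + 4) + V₁.card * (L.length * (2 * q + 4)) ≤
        (V₁.card + 1) * (L.length * (2 * (q + 1) + 4)) := by
      rw [add_comm (L.length * _), ← Nat.succ_mul]
      gcongr
      omega
    refine Comp.mono_cost ?_ hcost
    refine (eliminate hb' hL).bind fun X₁ K₁ hX₁ hK₁ h => ?_
    obtain ⟨L₁, hlen, hL₁, h⟩ := h
    rw [← hlen]
    refine (ih hV.2 (hK₁ h0) hL₁).weaken fun X₂ K₂ hX₂ hK₂ h₂ => ?_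
    obtain ⟨L₂, hlen₂, hL₂, hsat₂, hext⟩ := h₂
    refine ⟨L₂, hlen₂, hL₂, fun ω hω y hy => hsat₂ ω hω y ?_, ?_⟩
    · rcases h with h | ⟨ρ, hρ, -, h⟩
      · exact (h ω (hX₂ hω) y).1 hy
      · exact ((h ω (hX₂ hω) y).1 hy).2
    · intro X₃ hX₃ K₃ hK₃ y hy hsat
      simp only [Finset.insert_union]
      have hcost' : V₁.card * (2 * q + 1) + (2 * q + 1) ≤
          (V₁.card + 1) * (2 * (q + 1) + 1) := by
        rw [← Nat.succ_mul]
        gcongr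
        omega
      refine Comp.mono_cost ?_ hcost'
      refine (hext X₃ hX₃ K₃ hK₃ y hy hsat).bind fun X₄ K₄ hX₄ hK₄ h₄ => ?_
      obtain ⟨y', hy', hyy', hsat'⟩ := h₄
      have extend : ∀ f : Ω → ℝ, ∀ K', K₄ ⊆ K' → ∀ X' ⊆ X₄, f ∈ K' →
          (∀ ω ∈ X', ∀ r ∈ L, r.Sat (insert b (V₁ ∪ V₂)) ω
            fun k => Function.update y' b f k ω) →
          ∃ y'' : γ → Ω → ℝ, (∀ k ∈ insert b (V₁ ∪ V₂), y'' k ∈ K') ∧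
            (∀ k ∈ V₂, y'' k = y k) ∧
            ∀ ω ∈ X', ∀ r ∈ L, r.Sat (insert b (V₁ ∪ V₂)) ω fun k => y'' k ω := by
        intro f K' hK' X' hX' hf hs
        refine ⟨Function.update y' b f, fun k hk => ?_, fun k hk => ?_, hs⟩
        · rcases Finset.mem_insert.1 hk with rfl | hk
          · simpa using hf
          · rw [Function.update_of_ne (ne_of_mem_of_not_mem hk hb')]
            exact hK' (hy' k hk)
        · rw [Function.update_of_ne (ne_of_mem_of_not_mem hk hV.1), hyy' k hk]
      have agree : ∀ f : Ω → ℝ, ∀ ω, ∀ k ∈ V₁ ∪ V₂, Function.update y' b f k ω = y' k ω :=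
        fun f ω k hk => by rw [Function.update_of_ne (ne_of_mem_of_not_mem hk hb')]
      rcases h with h | ⟨ρ, hρ, hρ0, h⟩
      -- Without a pivot `b` does not occur in the equations; it receives the value `0`.
      · refine .done (extend _ K₄ subset_rfl X₄ subset_rfl
          (hK₄ (hK₃ (hK₂ (hK₁ h0)))) fun ω hω => ?_)
        rw [h ω (hX₂ (hX₃ (hX₄ hω)))]
        exact fun r hr => (Row.sat_congr (agree _ ω)).2 (hsat' ω hω r hr)
      · have hρK := (hL ρ hρ).mono subset_rfl (hK₁.trans (hK₂.trans (hK₃.trans hK₄)))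
        -- The pivot equation is solved for `b`: two operations for each other unknown, then one
        -- division.
        refine (sub_sum_mul hρK.2 (s := V₁ ∪ V₂) (fun k hk => hρK.1 k (by
          exact Finset.mem_insert_of_mem hk)) hy').bind fun X₅ K₅ hX₅ hK₅ h₅ => ?_
        refine (div h₅ (hK₅ (hρK.1 b (Finset.mem_insert_self _ _))) fun ω hω =>
          hρ0 ω (hX₂ (hX₃ (hX₄ (hX₅ hω))))).weaken fun X₆ K₆ hX₆ hK₆ h₆ => ?_
        refine extend _ K₆ (hK₅.trans hK₆) X₆ (hX₆.trans hX₅) h₆ fun ω hω => ?_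
        have hω₄ := hX₅ (hX₆ hω)
        have hω₁ := hX₂ (hX₃ (hX₄ hω₄))
        rw [h ω hω₁]
        refine ⟨?_, fun r hr => (Row.sat_congr (agree _ ω)).2 (hsat' ω hω₄ r hr)⟩
        rw [Row.sat_insert hb', Finset.sum_congr rfl fun k hk => by rw [agree _ ω k hk]]
        rw [Function.update_self, mul_div_cancel₀ _ (hρ0 ω hω₁)]
        ring

/-- Elimination of the unknowns `V₁` from a consistent system leads to a system that has at most as
many equations as the remaining unknowns `V₂`. -/
theorem project {V₁ V₂ : Finset γ} (hV : Disjoint V₁ V₂) (h0 : (fun _ => 0) ∈ K)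
    (hL : ∀ r ∈ L, r.Known (V₁ ∪ V₂) K) (hsol : ∀ ω ∈ X, ∃ y, ∀ r ∈ L, r.Sat (V₁ ∪ V₂) ω y) :
    Comp (fun X' K' => ∃ L' : List (Row γ Ω), L'.length ≤ V₂.card ∧ (∀ r ∈ L', r.Known V₂ K') ∧
      (∀ ω ∈ X', ∀ y, (∀ r ∈ L, r.Sat (V₁ ∪ V₂) ω y) → ∀ r ∈ L', r.Sat V₂ ω y) ∧
      Extendable L V₁ V₂ L' (V₁.card * (2 * (V₁ ∪ V₂).card + 1)) X' K')
      ((V₁ ∪ V₂).card * (L.length * (2 * (V₁ ∪ V₂).card + 4))) X K := by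
  have hcost : V₁.card * (L.length * (2 * (V₁ ∪ V₂).card + 4)) +
      V₂.card * (L.length * (2 * V₂.card + 4)) ≤
      (V₁ ∪ V₂).card * (L.length * (2 * (V₁ ∪ V₂).card + 4)) := by
    rw [Finset.card_union_of_disjoint hV, add_mul]
    gcongr
    omega
  refine Comp.mono_cost ?_ hcost
  refine (eliminate_finset hV h0 hL).bind fun X₁ K₁ hX₁ hK₁ h => ?_
  obtain ⟨L₁, hlen, hL₁, hsat, hext⟩ := h
  rw [← hlen]
  -- There are still as many equations as in `L`, now in the unknowns `V₂` only; the redundant ones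
  -- are removed.
  refine (reduce (hK₁ h0) hL₁ fun ω hω => ?_).weaken fun X₂ K₂ hX₂ hK₂ h => ?_
  · obtain ⟨y, hy⟩ := hsol ω (hX₁ hω)
    exact ⟨y, hsat ω hω y hy⟩
  · obtain ⟨L₂, hlen₂, hL₂, hiff⟩ := h
    refine ⟨L₂, hlen₂, hL₂, fun ω hω y hy => (hiff ω hω y).1 (hsat ω (hX₂ hω) y hy), ?_⟩
    intro X₃ hX₃ K₃ hK₃ y hy hs
    exact hext X₃ (hX₃.trans hX₂) K₃ (hK₂.trans hK₃) y hy
      fun ω hω => (hiff ω (hX₃ hω) _).2 (hs ω hω)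

end Comp

/-! ### Linear systems distributed over the nodes of a tree -/

/-- An order in which the nodes in `s` can be eliminated: the eliminated node `j` has a neighbour
`p` whose bag contains everything that the bag of `j` shares with other bags. -/
inductive EliminationOrder {I κ : Type*} [DecidableEq I] (B : I → Finset κ) : Finset I → Prop
  | single (i : I) : EliminationOrder B {i}
  | insert {s : Finset I} {j p : I} (hj : j ∉ s) (hp : p ∈ s)
      (h : ∀ a ∈ B j, ∀ i ∈ s, a ∈ B i → a ∈ B p) (hs : EliminationOrder B s) :
      EliminationOrder B (insert j s)

/-- A linear equation between states `z` and flows `u`, both with components indexed by `κ`. -/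
structure NodeRow (κ Ω : Type*) where
  state : κ → Ω → ℝ
  flow : κ → Ω → ℝ
  rhs : Ω → ℝ

namespace NodeRow

variable {κ Ω : Type*}

/-- `z` and `u` solve the equation in the components in `B`. -/
def Sat (r : NodeRow κ Ω) (B : Finset κ) (ω : Ω) (z u : κ → ℝ) : Prop :=
  ∑ a ∈ B, r.state a ω * z a + ∑ a ∈ B, r.flow a ω * u a = r.rhs ω

/-- The right-hand side and the coefficients at `B` lie in `K`. -/
def Known (r : NodeRow κ Ω) (B : Finset κ) (K : Set (Ω → ℝ)) : Prop :=
  (∀ a ∈ B, r.state a ∈ K ∧ r.flow a ∈ K) ∧ r.rhs ∈ K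

theorem Known.mono {r : NodeRow κ Ω} {B : Finset κ} {K K' : Set (Ω → ℝ)} (h : r.Known B K)
    (hK : K ⊆ K') : r.Known B K' :=
  ⟨fun a ha => ⟨hK (h.1 a ha).1, hK (h.1 a ha).2⟩, hK h.2⟩

theorem sat_congr {r : NodeRow κ Ω} {B : Finset κ} {ω : Ω} {z z' u u' : κ → ℝ}
    (hz : ∀ a ∈ B, z a = z' a) (hu : ∀ a ∈ B, u a = u' a) : r.Sat B ω z u ↔ r.Sat B ω z' u' := by
  rw [Sat, Sat, Finset.sum_congr rfl fun a ha => by rw [hz a ha],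
    Finset.sum_congr (f := fun a => r.flow a ω * u a) rfl fun a ha => by rw [hu a ha]]

end NodeRow

/-- The unknowns in the elimination of a node: states, flows of the neighbour after the
elimination, flows of the neighbour before it, and flows of the node. -/
abbrev LocalUnknown (κ : Type*) : Type _ :=
  Σ _ : Fin 4, κ

namespace LocalUnknown

variable {κ : Type*}

/-- The unknowns that are kept. -/
def kept (Bp : Finset κ) : Finset (LocalUnknown κ) :=
  Finset.univ.sigma ![Bp, Bp, ∅, ∅]

theorem card_kept (Bp : Finset κ) : (kept Bp).card = 2 * Bp.card := by
  simp [kept, Finset.card_sigma, Fin.sum_univ_four]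
  omega

/-- Values of all unknowns, given by their kinds. -/
def values {α : Type*} (z u' up uj : κ → α) (c : LocalUnknown κ) : α :=
  ![z, u', up, uj] c.1 c.2

variable [DecidableEq κ]

/-- The unknowns to be eliminated together with the node with bag `Bj`. -/
def eliminated (Bj Bp : Finset κ) : Finset (LocalUnknown κ) :=
  Finset.univ.sigma ![Bj \ Bp, ∅, Bp, Bj]

/-- All local unknowns. -/
def all (Bj Bp : Finset κ) : Finset (LocalUnknown κ) :=
  Finset.univ.sigma ![Bj ∪ Bp, Bp, Bp, Bj]

theorem eliminated_union_kept (Bj Bp : Finset κ) :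
    eliminated Bj Bp ∪ kept Bp = all Bj Bp := by
  ext ⟨k, a⟩
  fin_cases k <;> simp [eliminated, kept, all, Finset.mem_sigma]
  tauto

theorem disjoint_eliminated_kept (Bj Bp : Finset κ) : Disjoint (eliminated Bj Bp) (kept Bp) := by
  rw [Finset.disjoint_left]
  rintro ⟨k, a⟩
  fin_cases k <;> simp [eliminated, kept, Finset.mem_sigma]

theorem card_eliminated_le {Bj Bp : Finset κ} {w : ℕ} (hj : Bj.card ≤ w) (hp : Bp.card ≤ w) :
    (eliminated Bj Bp).card ≤ 3 * w := by
  have := Finset.card_le_card (Finset.sdiff_subset (s := Bj) (t := Bp))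
  simp [eliminated, Finset.card_sigma, Fin.sum_univ_four]
  omega

theorem card_all_le {Bj Bp : Finset κ} {w : ℕ} (hj : Bj.card ≤ w) (hp : Bp.card ≤ w) :
    (all Bj Bp).card ≤ 5 * w := by
  have := Finset.card_union_le Bj Bp
  simp [all, Finset.card_sigma, Fin.sum_univ_four]
  omega

end LocalUnknown

/-! ### Node equations as equations in the local unknowns -/

namespace NodeRow

variable {κ Ω : Type*}

open LocalUnknown

/-- An equation between kept unknowns as an equation of the neighbour. -/
def ofRow (r : Row (LocalUnknown κ) Ω) : NodeRow κ Ω where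
  state a := r.coef ⟨0, a⟩
  flow a := r.coef ⟨1, a⟩
  rhs := r.rhs

theorem known_ofRow {r : Row (LocalUnknown κ) Ω} {B : Finset κ} {K : Set (Ω → ℝ)}
    (h : r.Known (kept B) K) : (ofRow r).Known B K :=
  ⟨fun a ha => ⟨h.1 ⟨0, a⟩ (by simpa [kept, Finset.mem_sigma] using ha),
    h.1 ⟨1, a⟩ (by simpa [kept, Finset.mem_sigma] using ha)⟩, h.2⟩

theorem sat_ofRow {r : Row (LocalUnknown κ) Ω} {B : Finset κ} {ω : Ω} {y : LocalUnknown κ → ℝ} :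
    (ofRow r).Sat B ω (fun a => y ⟨0, a⟩) (fun a => y ⟨1, a⟩) ↔ r.Sat (kept B) ω y := by
  simp [Sat, Row.Sat, kept, Finset.sum_sigma, Fin.sum_univ_four, ofRow]

variable [DecidableEq κ]

/-- The equation `r` of the eliminated node with bag `B` in terms of the local unknowns. -/
def ofLeaf (B : Finset κ) (r : NodeRow κ Ω) : Row (LocalUnknown κ) Ω where
  coef c := if c.2 ∈ B then ![r.state c.2, fun _ => 0, fun _ => 0, r.flow c.2] c.1 else fun _ => 0
  rhs := r.rhs

/-- The equation `r` of the neighbour with bag `B` in terms of the local unknowns. -/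
def ofNeighbor (B : Finset κ) (r : NodeRow κ Ω) : Row (LocalUnknown κ) Ω where
  coef c := if c.2 ∈ B then ![r.state c.2, fun _ => 0, r.flow c.2, fun _ => 0] c.1 else fun _ => 0
  rhs := r.rhs

/-- The equation which says that the flow of the neighbour after the elimination is the sum of its
flow before and of the flow of the eliminated node, in the component `a`. -/
def balance (Ω : Type*) (a : κ) : Row (LocalUnknown κ) Ω where
  coef c := if c.2 = a then ![fun _ => 0, fun _ => -1, fun _ => 1, fun _ => 1] c.1 else fun _ => 0
  rhs := fun _ => 0

theorem Known.ofLeaf {r : NodeRow κ Ω} {B : Finset κ} {K : Set (Ω → ℝ)} (h : r.Known B K)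
    (h0 : (fun _ => 0) ∈ K) (V : Finset (LocalUnknown κ)) : (r.ofLeaf B).Known V K := by
  refine ⟨?_, h.2⟩
  rintro ⟨k, a⟩ -
  by_cases ha : a ∈ B
  · fin_cases k <;> simp [NodeRow.ofLeaf, ha, h0, (h.1 a ha).1, (h.1 a ha).2]
  · simpa [NodeRow.ofLeaf, ha] using h0

theorem Known.ofNeighbor {r : NodeRow κ Ω} {B : Finset κ} {K : Set (Ω → ℝ)} (h : r.Known B K)
    (h0 : (fun _ => 0) ∈ K) (V : Finset (LocalUnknown κ)) : (r.ofNeighbor B).Known V K := by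
  refine ⟨?_, h.2⟩
  rintro ⟨k, a⟩ -
  by_cases ha : a ∈ B
  · fin_cases k <;> simp [NodeRow.ofNeighbor, ha, h0, (h.1 a ha).1, (h.1 a ha).2]
  · simpa [NodeRow.ofNeighbor, ha] using h0

theorem known_balance {K : Set (Ω → ℝ)} (h0 : (fun _ => 0) ∈ K) (h1 : (fun _ => 1) ∈ K)
    (h1' : (fun _ => -1) ∈ K) (a : κ) (V : Finset (LocalUnknown κ)) :
    (balance Ω a).Known V K := by
  refine ⟨?_, h0⟩
  rintro ⟨k, b⟩ -
  by_cases ha : b = a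
  · fin_cases k <;> simp [balance, ha, h0, h1, h1']
  · simpa [balance, ha] using h0

theorem sat_ofLeaf {r : NodeRow κ Ω} {Bj Bp : Finset κ} {ω : Ω} {y : LocalUnknown κ → ℝ} :
    (r.ofLeaf Bj).Sat (all Bj Bp) ω y ↔
      r.Sat Bj ω (fun a => y ⟨0, a⟩) (fun a => y ⟨3, a⟩) := by
  have h : ∑ a ∈ Bj ∪ Bp, (r.ofLeaf Bj).coef ⟨0, a⟩ ω * y ⟨0, a⟩ =
      ∑ a ∈ Bj, r.state a ω * y ⟨0, a⟩ := by
    rw [← Finset.sum_subset Finset.subset_union_left fun a _ ha => by simp [NodeRow.ofLeaf, ha]]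
    exact Finset.sum_congr rfl fun a ha => by simp [NodeRow.ofLeaf, ha]
  have h' : ∑ a ∈ Bj, (r.ofLeaf Bj).coef ⟨3, a⟩ ω * y ⟨3, a⟩ =
      ∑ a ∈ Bj, r.flow a ω * y ⟨3, a⟩ :=
    Finset.sum_congr rfl fun a ha => by simp [NodeRow.ofLeaf, ha]
  have h₁ : ∀ a, (r.ofLeaf Bj).coef ⟨1, a⟩ ω = 0 := fun a => by
    simp only [NodeRow.ofLeaf]; split_ifs <;> simp
  have h₂ : ∀ a, (r.ofLeaf Bj).coef ⟨2, a⟩ ω = 0 := fun a => by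
    simp only [NodeRow.ofLeaf]; split_ifs <;> simp
  simp [Sat, Row.Sat, all, Finset.sum_sigma, Fin.sum_univ_four, h, h', h₁, h₂]
  rfl

theorem sat_ofNeighbor {r : NodeRow κ Ω} {Bj Bp : Finset κ} {ω : Ω} {y : LocalUnknown κ → ℝ} :
    (r.ofNeighbor Bp).Sat (all Bj Bp) ω y ↔
      r.Sat Bp ω (fun a => y ⟨0, a⟩) (fun a => y ⟨2, a⟩) := by
  have h : ∑ a ∈ Bj ∪ Bp, (r.ofNeighbor Bp).coef ⟨0, a⟩ ω * y ⟨0, a⟩ =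
      ∑ a ∈ Bp, r.state a ω * y ⟨0, a⟩ := by
    rw [← Finset.sum_subset Finset.subset_union_right
      fun a _ ha => by simp [NodeRow.ofNeighbor, ha]]
    exact Finset.sum_congr rfl fun a ha => by simp [NodeRow.ofNeighbor, ha]
  have h' : ∑ a ∈ Bp, (r.ofNeighbor Bp).coef ⟨2, a⟩ ω * y ⟨2, a⟩ =
      ∑ a ∈ Bp, r.flow a ω * y ⟨2, a⟩ :=
    Finset.sum_congr rfl fun a ha => by simp [NodeRow.ofNeighbor, ha]
  have h₁ : ∀ a, (r.ofNeighbor Bp).coef ⟨1, a⟩ ω = 0 := fun a => by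
    simp only [NodeRow.ofNeighbor]; split_ifs <;> simp
  have h₂ : ∀ a, (r.ofNeighbor Bp).coef ⟨3, a⟩ ω = 0 := fun a => by
    simp only [NodeRow.ofNeighbor]; split_ifs <;> simp
  simp [Sat, Row.Sat, all, Finset.sum_sigma, Fin.sum_univ_four, h, h', h₁, h₂]
  rfl

/-- For `a` in `Bp` this is the definition of the merged flow. For `a` in `Bj \ Bp` it says that the
flow of the eliminated node vanishes, as it must because no other bag contains `a`. -/
theorem sat_balance {Bj Bp : Finset κ} {a : κ} {ω : Ω} {y : LocalUnknown κ → ℝ} :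
    (balance Ω a).Sat (all Bj Bp) ω y ↔
      (if a ∈ Bp then y ⟨2, a⟩ else 0) + (if a ∈ Bj then y ⟨3, a⟩ else 0) =
        if a ∈ Bp then y ⟨1, a⟩ else 0 := by
  have h : ∀ (S : Finset κ) (k : Fin 4), ∑ b ∈ S, (balance Ω a).coef ⟨k, b⟩ ω * y ⟨k, b⟩ =
      (if a ∈ S then ![0, -1, 1, 1] k * y ⟨k, a⟩ else 0) := by
    intro S k
    rw [← Finset.sum_ite_eq' S a fun b => ![0, -1, 1, 1] k * y ⟨k, b⟩]
    refine Finset.sum_congr rfl fun b _ => ?_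
    by_cases hb : b = a
    · fin_cases k <;> simp [balance, hb]
    · simp [balance, hb]
  rw [Row.Sat, all, Finset.sum_sigma, Fin.sum_univ_four]
  simp only [h]
  simp only [balance]
  by_cases ha : a ∈ Bp <;> by_cases ha' : a ∈ Bj <;> simp [ha, ha'] <;>
    constructor <;> intro h <;> linarith

end NodeRow

/-- States `z` and flows `u` solve the equations `L i` at all nodes in `s`, the flow at a node
vanishes outside of its bag, and the flows sum up to zero. -/
def TreeSolution {I κ Ω : Type*} (B : I → Finset κ) (s : Finset I) (L : I → List (NodeRow κ Ω))
    (ω : Ω) (z : κ → ℝ) (u : I → κ → ℝ) : Prop :=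
  (∀ i ∈ s, ∀ r ∈ L i, r.Sat (B i) ω z (u i)) ∧ (∀ i ∈ s, ∀ a ∉ B i, u i a = 0) ∧
    ∀ a, ∑ i ∈ s, u i a = 0

theorem Nat.sq_le_cube (w : ℕ) : w ^ 2 ≤ w ^ 3 := by
  rcases Nat.eq_zero_or_pos w with rfl | hw
  · simp
  · exact Nat.pow_le_pow_right hw (by norm_num)

/-! ### Elimination of a tree node and solution along the tree -/

namespace Comp

variable {I κ Ω : Type*} [DecidableEq κ] {B : I → Finset κ} {X : Set Ω} {K : Set (Ω → ℝ)}

open LocalUnknown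

/-- The local system in the elimination of the node `j` with neighbour `p`. -/
noncomputable def localSystem (B : I → Finset κ) (L : I → List (NodeRow κ Ω)) (j p : I) :
    List (Row (LocalUnknown κ) Ω) :=
  (L j).map (NodeRow.ofLeaf (B j)) ++ (L p).map (NodeRow.ofNeighbor (B p)) ++
    (B j ∪ B p).toList.map (NodeRow.balance Ω)

theorem forall_mem_localSystem {L : I → List (NodeRow κ Ω)} {j p : I}
    {P : Row (LocalUnknown κ) Ω → Prop} :
    (∀ r ∈ localSystem B L j p, P r) ↔ (∀ r ∈ L j, P (r.ofLeaf (B j))) ∧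
      (∀ r ∈ L p, P (r.ofNeighbor (B p))) ∧ ∀ a ∈ B j ∪ B p, P (NodeRow.balance Ω a) := by
  simp only [localSystem, List.forall_mem_append, List.forall_mem_map, Finset.mem_toList,
    and_assoc]

/-- A linear system with one node. -/
theorem solve_node {w : ℕ} {i : I} (hw : (B i).card ≤ w) {L : I → List (NodeRow κ Ω)}
    (hlen : (L i).length ≤ 2 * (B i).card) (hL : ∀ r ∈ L i, r.Known (B i) K)
    (h0 : (fun _ => 0) ∈ K) (hsol : ∀ ω ∈ X, ∃ z u, TreeSolution B {i} L ω z u) :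
    Comp (fun X' K' => ∃ (z : κ → Ω → ℝ) (u : I → κ → Ω → ℝ), (∀ a, z a ∈ K') ∧
      (∀ k ∈ ({i} : Finset I), ∀ a, u k a ∈ K') ∧
      ∀ ω ∈ X', TreeSolution B {i} L ω (fun a => z a ω) fun k a => u k a ω) (475 * w ^ 3) X K := by
  -- With a single node the sum of the flows is its own flow, which is therefore zero; only the
  -- states remain as unknowns.
  set L₀ : List (Row κ Ω) := (L i).map fun r => ⟨r.state, r.rhs⟩ with hL₀
  have hL₀K : ∀ r ∈ L₀, r.Known (B i ∪ ∅) K := by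
    rw [hL₀, List.forall_mem_map, Finset.union_empty]
    exact fun r hr => ⟨fun a ha => ((hL r hr).1 a ha).1, (hL r hr).2⟩
  have hsat : ∀ ω z, (∀ r ∈ L₀, r.Sat (B i ∪ ∅) ω z) ↔
      ∀ r ∈ L i, r.Sat (B i) ω z fun _ => 0 := by
    intro ω z
    rw [hL₀, List.forall_mem_map, Finset.union_empty]
    simp [Row.Sat, NodeRow.Sat]
  have hcost : (B i).card * (L₀.length * (2 * (B i ∪ ∅).card + 4)) +
      (B i).card * (2 * (B i ∪ ∅).card + 1) ≤ 475 * w ^ 3 := by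
    rw [Finset.union_empty, hL₀, List.length_map]
    calc _ ≤ w * (2 * w * (2 * w + 4)) + w * (2 * w + 1) := by gcongr; omega
      _ = 4 * w ^ 3 + 10 * w ^ 2 + w := by ring
      _ ≤ 4 * w ^ 3 + 10 * w ^ 3 + w ^ 3 := by
        have h₂ : w ^ 2 ≤ w ^ 3 := Nat.sq_le_cube w
        have h₃ : w ≤ w ^ 3 := Nat.le_self_pow (by norm_num) w
        gcongr
      _ ≤ 475 * w ^ 3 := by linarith [Nat.zero_le (w ^ 3)]
  refine Comp.mono_cost ?_ hcost
  refine (eliminate_finset (Finset.disjoint_empty_right (B i)) h0 hL₀K).bind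
    fun X₁ K₁ hX₁ hK₁ h => ?_
  obtain ⟨L₁, -, -, hL₁, hext⟩ := h
  refine (hext X₁ subset_rfl K₁ subset_rfl (fun _ _ => 0) (by simp) fun ω hω => ?_).weaken
    fun X₂ K₂ hX₂ hK₂ h => ?_
  · obtain ⟨z, u, hu⟩ := hsol ω (hX₁ hω)
    have hui : u i = fun _ => 0 := funext fun a => by simpa using hu.2.2 a
    -- After elimination of all states the equations contain no unknowns, so the known solution
    -- shows that they hold.
    have := hL₁ ω hω z ((hsat ω z).2 (by simpa only [hui] using hu.1 i (by simp)))
    exact fun r hr => (Row.sat_congr (by simp)).1 (this r hr)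
  · obtain ⟨y, hyK, -, hy⟩ := h
    have h0' : (fun _ => 0) ∈ K₂ := hK₂ (hK₁ h0)
    refine ⟨fun a => if a ∈ B i then y a else fun _ => 0, fun _ _ _ => 0, fun a => ?_,
      fun _ _ _ => h0', fun ω hω => ⟨?_, by simp, by simp⟩⟩
    · by_cases ha : a ∈ B i
      · simpa [ha] using hyK a (by simp [ha])
      · simpa [ha] using h0'
    · simp only [Finset.mem_singleton, forall_eq]
      intro r hr
      refine (NodeRow.sat_congr (fun a ha => ?_) fun _ _ => rfl).1
        ((hsat ω _).1 (hy ω hω) r hr)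
      simp [ha]

variable [DecidableEq I]

/-- If `a` lies in `B j` but not in `B p`, no remaining bag contains it, so `u j a` is the only
possible nonzero term in a sum that vanishes. -/
theorem _root_.TreeSolution.flow_eq_zero {s : Finset I} {j p : I} (hj : j ∉ s)
    (h : ∀ a ∈ B j, ∀ i ∈ s, a ∈ B i → a ∈ B p) {L : I → List (NodeRow κ Ω)} {ω : Ω} {z : κ → ℝ}
    {u : I → κ → ℝ} (hu : TreeSolution B (insert j s) L ω z u) {a : κ} (ha : a ∉ B p) :
    u j a = 0 := by
  by_cases haj : a ∈ B j
  · have := hu.2.2 a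
    rw [Finset.sum_insert hj, Finset.sum_eq_zero fun i hi => ?_, add_zero] at this
    · exact this
    · exact hu.2.1 i (by simp [hi]) a fun hai => ha (h a haj i hi hai)
  · exact hu.2.1 j (by simp) a haj

/-- Consistency of the whole system passes to the local one, as `project` requires. -/
theorem _root_.TreeSolution.localSystem {s : Finset I} {j p : I} (hj : j ∉ s) (hp : p ∈ s)
    (h : ∀ a ∈ B j, ∀ i ∈ s, a ∈ B i → a ∈ B p) {L : I → List (NodeRow κ Ω)} {ω : Ω} {z : κ → ℝ}
    {u : I → κ → ℝ} (hu : TreeSolution B (insert j s) L ω z u) :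
    ∀ r ∈ Comp.localSystem B L j p,
      r.Sat (all (B j) (B p)) ω (values z (fun a => u p a + u j a) (u p) (u j)) := by
  rw [forall_mem_localSystem]
  refine ⟨fun r hr => NodeRow.sat_ofLeaf.2 (hu.1 j (by simp) r hr),
    fun r hr => NodeRow.sat_ofNeighbor.2 (hu.1 p (by simp [hp]) r hr), fun a _ => ?_⟩
  rw [NodeRow.sat_balance]
  have hj0 := hu.2.1 j (by simp) a
  have hp0 := hu.flow_eq_zero hj h (a := a)
  by_cases haj : a ∈ B j <;> by_cases hap : a ∈ B p <;> simp_all [values]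

/-- Moving the flow of `j` to `p` preserves the total flow, and it does not leave the bag of `p` by
`TreeSolution.flow_eq_zero`. This gives consistency of the smaller system. -/
theorem _root_.TreeSolution.reduce {s : Finset I} {j p : I} (hj : j ∉ s) (hp : p ∈ s)
    (h : ∀ a ∈ B j, ∀ i ∈ s, a ∈ B i → a ∈ B p) {L : I → List (NodeRow κ Ω)} {ω : Ω} {z : κ → ℝ}
    {u : I → κ → ℝ} (hu : TreeSolution B (insert j s) L ω z u)
    {L' : List (Row (LocalUnknown κ) Ω)}
    (hL' : ∀ r ∈ L', r.Sat (kept (B p)) ω (values z (fun a => u p a + u j a) (u p) (u j))) :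
    TreeSolution B s (Function.update L p (L'.map NodeRow.ofRow)) ω z
      (Function.update u p fun a => u p a + u j a) := by
  refine ⟨fun i hi => ?_, fun i hi a ha => ?_, fun a => ?_⟩
  · rcases eq_or_ne i p with rfl | hip
    · simp only [Function.update_self, List.forall_mem_map]
      exact fun r hr => NodeRow.sat_ofRow.2 (hL' r hr)
    · simpa only [Function.update_of_ne hip] using hu.1 i (by simp [hi])
  · rcases eq_or_ne i p with rfl | hip
    · simp only [Function.update_self]
      rw [hu.flow_eq_zero hj h ha, hu.2.1 i (by simp [hi]) a ha, add_zero]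
    · simpa only [Function.update_of_ne hip] using hu.2.1 i (by simp [hi]) a ha
  · have := hu.2.2 a
    rw [Finset.sum_insert hj, ← Finset.add_sum_erase s _ hp] at this
    rw [← Finset.add_sum_erase s _ hp, Finset.sum_congr rfl fun i hi => by
      rw [Function.update_of_ne (Finset.ne_of_mem_erase hi)]]
    simp only [Function.update_self]
    linarith

/-- The states on all nodes, from states `z` on the remaining nodes and local values `y`. -/
def extendState (Bj Bp : Finset κ) {α : Type*} (z : κ → α) (y : LocalUnknown κ → α) (a : κ) : α :=
  if a ∈ Bj \ Bp then y ⟨0, a⟩ else z a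

/-- The flows at all nodes, from flows `u` at the remaining nodes and local values `y`. -/
def extendFlow (B : I → Finset κ) (j p : I) {α : Type*} (zero : α) (u : I → κ → α)
    (y : LocalUnknown κ → α) (i : I) (a : κ) : α :=
  if i = j then if a ∈ B j then y ⟨3, a⟩ else zero
  else if i = p then if a ∈ B p then y ⟨2, a⟩ else zero
  else u i a

/-- The converse of the reduction: local values that agree with the smaller solution on the kept
unknowns split the flow of `p` into flows of `p` and `j` and supply the states private to `j`. -/
theorem _root_.TreeSolution.extend {s : Finset I} {j p : I} (hj : j ∉ s) (hp : p ∈ s)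
    (h : ∀ a ∈ B j, ∀ i ∈ s, a ∈ B i → a ∈ B p) {L : I → List (NodeRow κ Ω)} {ω : Ω} {z : κ → ℝ}
    {u : I → κ → ℝ} {Lp : List (NodeRow κ Ω)}
    (hu : TreeSolution B s (Function.update L p Lp) ω z u) {y : LocalUnknown κ → ℝ}
    (hyz : ∀ a ∈ B p, y ⟨0, a⟩ = z a) (hyu : ∀ a ∈ B p, y ⟨1, a⟩ = u p a)
    (hy : ∀ r ∈ Comp.localSystem B L j p, r.Sat (all (B j) (B p)) ω y) :
    TreeSolution B (insert j s) L ω (extendState (B j) (B p) z y)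
      (extendFlow B j p 0 u y) := by
  have hpj : p ≠ j := ne_of_mem_of_not_mem hp hj
  rw [forall_mem_localSystem] at hy
  obtain ⟨hleaf, hneighbor, hbalance⟩ := hy
  -- The balance equations give this on `B j ∪ B p`; elsewhere all three flows are zero.
  have hflow : ∀ a, extendFlow B j p 0 u y j a + extendFlow B j p 0 u y p a = u p a := by
    intro a
    have hp0 := hu.2.1 p hp a
    by_cases ha : a ∈ B j ∪ B p
    · have hb := NodeRow.sat_balance.1 (hbalance a ha)
      simp only [extendFlow, if_true, if_neg hpj]
      rw [add_comm, hb]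
      split_ifs with hap
      · exact hyu a hap
      · exact (hp0 hap).symm
    · rw [Finset.mem_union, not_or] at ha
      simp [extendFlow, hpj, ha.1, ha.2, hp0 ha.2]
  refine ⟨fun i hi r hr => ?_, fun i hi a ha => ?_, fun a => ?_⟩
  · rcases Finset.mem_insert.1 hi with rfl | hi
    · refine (NodeRow.sat_congr (fun a ha => ?_) fun a ha => ?_).1
        (NodeRow.sat_ofLeaf.1 (hleaf r hr))
      · by_cases hap : a ∈ B p <;> simp [extendState, ha, hap, hyz]
      · simp [extendFlow, ha]
    · have hij : i ≠ j := ne_of_mem_of_not_mem hi hj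
      rcases eq_or_ne i p with rfl | hip
      · refine (NodeRow.sat_congr (fun a ha => ?_) fun a ha => ?_).1
          (NodeRow.sat_ofNeighbor.1 (hneighbor r hr))
        · simp [extendState, ha, hyz]
        · simp [extendFlow, hij, ha]
      · have := hu.1 i hi r (by rwa [Function.update_of_ne hip])
        refine (NodeRow.sat_congr (fun a ha => ?_) fun a ha => ?_).1 this
        -- The states that were overwritten occur in no remaining bag, so the equations at other
        -- nodes are not affected.
        · have : a ∉ B j \ B p := fun h' =>
            (Finset.mem_sdiff.1 h').2 (h a (Finset.mem_sdiff.1 h').1 i hi ha)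
          rw [extendState, if_neg this]
        · simp [extendFlow, hij, hip]
  · rcases Finset.mem_insert.1 hi with rfl | hi
    · simp [extendFlow, ha]
    · have hij : i ≠ j := ne_of_mem_of_not_mem hi hj
      rcases eq_or_ne i p with rfl | hip
      · simp [extendFlow, ha, hij]
      · simpa [extendFlow, hij, hip] using hu.2.1 i hi a ha
  · have hsum := hu.2.2 a
    rw [← Finset.add_sum_erase s _ hp] at hsum
    rw [Finset.sum_insert hj, ← Finset.add_sum_erase s _ hp, ← add_assoc, hflow, ← hsum]
    congr 1
    refine Finset.sum_congr rfl fun i hi => ?_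
    have hij : i ≠ j := ne_of_mem_of_not_mem (Finset.mem_of_mem_erase hi) hj
    simp [extendFlow, hij, Finset.ne_of_mem_erase hi]

/-- A consistent linear system that is distributed over the nodes of a tree can be solved with a
number of operations that is linear in the number of nodes and cubic in the size of the bags. -/
theorem solve_tree {s : Finset I} (hs : EliminationOrder B s) {w : ℕ} (hw : ∀ i, (B i).card ≤ w)
    {L : I → List (NodeRow κ Ω)} (hlen : ∀ i ∈ s, (L i).length ≤ 2 * (B i).card)
    (hL : ∀ i ∈ s, ∀ r ∈ L i, r.Known (B i) K) (h0 : (fun _ => 0) ∈ K) (h1 : (fun _ => 1) ∈ K)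
    (h1' : (fun _ => -1) ∈ K) (hsol : ∀ ω ∈ X, ∃ z u, TreeSolution B s L ω z u) :
    Comp (fun X' K' => ∃ (z : κ → Ω → ℝ) (u : I → κ → Ω → ℝ), (∀ a, z a ∈ K') ∧
      (∀ i ∈ s, ∀ a, u i a ∈ K') ∧
      ∀ ω ∈ X', TreeSolution B s L ω (fun a => z a ω) fun i a => u i a ω)
      (s.card * (475 * w ^ 3)) X K := by
  induction hs generalizing X K L with
  | single i =>
    rw [Finset.card_singleton, one_mul]
    exact solve_node (hw i) (hlen i (by simp)) (hL i (by simp)) h0 hsol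
  | @insert s j p hj hp h _ ih =>
    set V := all (B j) (B p) with hV
    have hunion := eliminated_union_kept (B j) (B p)
    rw [← hV] at hunion
    have hVcard : V.card ≤ 5 * w := card_all_le (hw j) (hw p)
    have hlocal_length : (localSystem B L j p).length ≤ 6 * w := by
      have h₁ := hlen j (by simp)
      have h₂ := hlen p (by simp [hp])
      have h₃ := Finset.card_union_le (B j) (B p)
      have := hw j
      have := hw p
      simp only [localSystem, List.length_append, List.length_map, Finset.length_toList]
      omega
    have hcost : V.card * ((localSystem B L j p).length * (2 * V.card + 4)) +
        (s.card * (475 * w ^ 3) + (eliminated (B j) (B p)).card * (2 * V.card + 1)) ≤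
        (insert j s).card * (475 * w ^ 3) := by
      rw [Finset.card_insert_of_notMem hj]
      -- There are at most `5 * w` local unknowns, `3 * w` of them to be eliminated, and `6 * w`
      -- equations: `2 * w` from each node and `2 * w` balances. The total, at most `453 * w ^ 3`,
      -- leaves some room.
      calc _ ≤ 5 * w * (6 * w * (2 * (5 * w) + 4)) +
            (s.card * (475 * w ^ 3) + 3 * w * (2 * (5 * w) + 1)) := by
            gcongr
            exact card_eliminated_le (hw j) (hw p)
        _ = s.card * (475 * w ^ 3) + (300 * w ^ 3 + 150 * w ^ 2 + 3 * w) := by ring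
        _ ≤ s.card * (475 * w ^ 3) + (300 * w ^ 3 + 150 * w ^ 3 + 3 * w ^ 3) := by
          have h₂ : w ^ 2 ≤ w ^ 3 := Nat.sq_le_cube w
          have h₃ : w ≤ w ^ 3 := Nat.le_self_pow (by norm_num) w
          gcongr
        _ ≤ (s.card + 1) * (475 * w ^ 3) := by linarith [Nat.zero_le (w ^ 3)]
    refine Comp.mono_cost ?_ hcost
    have hproject := project (K := K) (X := X) (disjoint_eliminated_kept (B j) (B p)) h0
      (L := localSystem B L j p) (by
        rw [forall_mem_localSystem]
        exact ⟨fun r hr => (hL j (by simp) r hr).ofLeaf h0 _,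
          fun r hr => (hL p (by simp [hp]) r hr).ofNeighbor h0 _,
          fun a _ => NodeRow.known_balance h0 h1 h1' a _⟩) fun ω hω => by
        obtain ⟨z, u, hu⟩ := hsol ω hω
        rw [hunion]
        exact ⟨_, hu.localSystem hj hp h⟩
    rw [hunion] at hproject
    refine hproject.bind fun X₁ K₁ hX₁ hK₁ hG => ?_
    obtain ⟨L', hlen', hL', hsat, hext⟩ := hG
    rw [card_kept] at hlen'
    -- The projected system has at most as many equations as kept unknowns, `2 * (B p).card`, which
    -- restores the bound on the lengths.
    refine (ih (L := Function.update L p (L'.map NodeRow.ofRow)) (fun i hi => ?_)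
      (fun i hi => ?_) (hK₁ h0) (hK₁ h1) (hK₁ h1') fun ω hω => ?_).bind
      fun X₂ K₂ hX₂ hK₂ hG => ?_
    · rcases eq_or_ne i p with rfl | hip
      · simpa using hlen'
      · simpa only [Function.update_of_ne hip] using hlen i (by simp [hi])
    · rcases eq_or_ne i p with rfl | hip
      · rw [Function.update_self, List.forall_mem_map]
        exact fun r hr => NodeRow.known_ofRow (hL' r hr)
      · rw [Function.update_of_ne hip]
        exact fun r hr => (hL i (by simp [hi]) r hr).mono hK₁
    · obtain ⟨z, u, hu⟩ := hsol ω (hX₁ hω)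
      exact ⟨z, _, hu.reduce hj hp h
        (hsat ω hω _ (hu.localSystem hj hp h))⟩
    · obtain ⟨z, u, hz, hu, hsol'⟩ := hG
      have h0' : (fun _ => 0) ∈ K₂ := hK₂ (hK₁ h0)
      -- Only states and merged flows are kept unknowns; the last two arguments of `values` are
      -- fillers.
      refine (hext X₂ hX₂ K₂ hK₂ (values z (u p) (u p) (u p)) ?_ fun ω hω r hr => ?_).weaken
        fun X₃ K₃ hX₃ hK₃ hG => ?_
      · rintro ⟨k, a⟩ -
        have := hu p hp a
        fin_cases k <;> simp [values, hz, this]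
      · have := (hsol' ω hω).1 p hp (NodeRow.ofRow r) (by
          rw [Function.update_self]
          exact List.mem_map_of_mem hr)
        exact NodeRow.sat_ofRow.1 this
      · rw [hunion] at hG
        obtain ⟨y, hy, hyy, hys⟩ := hG
        have hyall : ∀ k a, a ∈ ![B j ∪ B p, B p, B p, B j] k → y ⟨k, a⟩ ∈ K₃ :=
          fun k a ha => hy _ (by rw [hV, all, Finset.mem_sigma]; exact ⟨Finset.mem_univ _, ha⟩)
        refine ⟨extendState (B j) (B p) z y, extendFlow B j p (fun _ => 0) u y, fun a => ?_,
          fun i hi a => ?_, fun ω hω => ?_⟩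
        · rw [extendState]
          split_ifs with ha
          · exact hyall 0 a (Finset.mem_union_left _ (Finset.mem_sdiff.1 ha).1)
          · exact hK₃ (hz a)
        · rw [extendFlow]
          split_ifs with hij ha hip ha
          · exact hyall 3 a ha
          · exact hK₃ h0'
          · exact hyall 2 a ha
          · exact hK₃ h0'
          · exact hK₃ (hu i (by simpa [hij] using hi) a)
        -- The extension is applied both to functions of the input and to their values at `ω`; the
        -- two agree case by case.
        · convert (hsol' ω (hX₃ hω)).extend hj hp h (y := fun c => y c ω)
            (fun a ha => ?_) (fun a ha => ?_) (hys ω hω) using 1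
          · funext a
            simp only [extendState]
            split_ifs <;> rfl
          · funext i a
            simp only [extendFlow]
            split_ifs <;> rfl
          · rw [hyy ⟨0, a⟩ (by simpa [kept, Finset.mem_sigma] using ha)]
            rfl
          · rw [hyy ⟨1, a⟩ (by simpa [kept, Finset.mem_sigma] using ha)]
            rfl

end Comp

/-! ### Elimination orders of tree decompositions -/

/-- Allows an order found on the complement of a leaf to be read in the whole tree. -/
theorem EliminationOrder.map {I J κ : Type*} [DecidableEq I] [DecidableEq J] {B : I → Finset κ}
    (f : J ↪ I) {s : Finset J} (h : EliminationOrder (fun j => B (f j)) s) :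
    EliminationOrder B (s.map f) := by
  induction h with
  | single i => simpa using EliminationOrder.single (f i)
  | @insert s j p hj hp h _ ih =>
    rw [Finset.map_insert]
    refine .insert (p := f p) (by simpa using hj) (by simpa using hp) (fun a ha i hi hai => ?_) ih
    obtain ⟨i', hi', rfl⟩ := Finset.mem_map.1 hi
    exact h a ha i' hi' hai

/-- If every `a` occurs in the bags of a connected set of nodes of a finite tree, then the nodes of
the tree can be eliminated one by one. -/
theorem SimpleGraph.IsTree.eliminationOrder {I κ : Type*} [Fintype I] [DecidableEq I]
    {T : SimpleGraph I} (hT : T.IsTree) {B : I → Finset κ}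
    (hB : ∀ a, (T.induce {i | a ∈ B i}).Preconnected) :
    EliminationOrder B Finset.univ := by
  classical
  induction hn : Fintype.card I generalizing I with
  | zero =>
    have := hT.connected.nonempty
    exact absurd hn Fintype.card_ne_zero
  | succ k ih =>
    rcases subsingleton_or_nontrivial I with _ | _
    · obtain ⟨i⟩ := hT.connected.nonempty
      convert EliminationOrder.single (B := B) i
      exact Finset.eq_singleton_iff_unique_mem.2 ⟨by simp, fun _ _ => Subsingleton.elim _ _⟩
    · obtain ⟨j, hj⟩ := hT.exists_vert_degree_one_of_nontrivial
      obtain ⟨p, hjp, hp⟩ := SimpleGraph.degree_eq_one_iff_existsUnique_adj.1 hj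
      have hT' : (T.induce {j}ᶜ).IsTree :=
        ⟨hT.connected.induce_compl_singleton_of_degree_eq_one hj, hT.isAcyclic.induce _⟩
      have hB' : ∀ a, ((T.induce {j}ᶜ).induce {i : ({j}ᶜ : Set I) | a ∈ B i}).Preconnected := by
        intro a
        -- The leaf `j` has at most one neighbour among the nodes whose bags contain `a`, so its
        -- removal does not disconnect them.
        have hleaf := (hB a).induce_of_degree_eq_one (s := {i | i.1 ≠ j}) (by
          rintro ⟨i, hi⟩ hij ⟨x, hx⟩ hix ⟨y, hy⟩ hiy
          obtain rfl : i = j := by simpa using hij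
          exact Subtype.ext ((hp x hix).trans (hp y hiy).symm))
        let φ : (T.induce {i | a ∈ B i}).induce {i | i.1 ≠ j} →g
            (T.induce {j}ᶜ).induce {i : ({j}ᶜ : Set I) | a ∈ B i} :=
          { toFun := fun i => ⟨⟨i.1.1, i.2⟩, i.1.2⟩
            map_rel' := fun h => h }
        exact hleaf.map φ fun i => ⟨⟨⟨i.1.1, i.2⟩, i.1.2⟩, rfl⟩
      have hcard : Fintype.card ({j}ᶜ : Set I) = k := by
        rw [Fintype.card_compl_set, hn]
        simp
      have hrest := (ih hT' (B := fun i => B i) hB' hcard).map (Function.Embedding.subtype _)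
      have huniv : (Finset.univ : Finset I) =
          insert j ((Finset.univ : Finset ({j}ᶜ : Set I)).map (Function.Embedding.subtype _)) := by
        ext i
        by_cases hij : i = j <;> simp [hij]
      rw [huniv]
      refine .insert (p := p) (by simp) (by simpa using hjp.ne') (fun a ha i hi hai => ?_) hrest
      have hij : i ≠ j := by simpa using hi
      -- If another bag contains `a`, connectedness gives `j` a neighbour whose bag contains `a`,
      -- and the only neighbour of `j` is `p`.
      have : Nontrivial {i | a ∈ B i} := ⟨⟨j, ha⟩, ⟨i, hai⟩, fun h => hij (by simpa using h.symm)⟩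
      obtain ⟨⟨q, hq⟩, hjq⟩ := (hB a).exists_adj_of_nontrivial ⟨j, ha⟩
      rwa [← hp q hjq]

/-! ### Solvers for linear systems with the sparsity pattern of a tree decomposition -/

section Solver

variable {κ I : Type*}

/-- All nonzero entries of `A` belong to pairs of indices in a common bag. -/
def SparseOn (B : I → Finset κ) (A : Matrix κ κ ℝ) : Prop :=
  ∀ a b, A a b ≠ 0 → ∃ i, a ∈ B i ∧ b ∈ B i

open scoped Classical in
/-- The equation of the node `i` for the component `a`: the part of the row `a` of the linear system
that is assigned to `i`. The entry at `(a, b)` is assigned to `owner a b`, and the right-hand side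
to `home a`. -/
noncomputable def nodeEquation (owner : κ → κ → I) (home : κ → I) (i : I) (a : κ) :
    NodeRow κ (Matrix κ κ ℝ × (κ → ℝ)) where
  state b := if owner a b = i then fun ω => ω.1 a b else fun _ => 0
  flow b := if b = a then fun _ => -1 else fun _ => 0
  rhs := if home a = i then fun ω => ω.2 a else fun _ => 0

open scoped Classical in
/-- The flow at the node `i` that is determined by the states `z`. -/
noncomputable def nodeFlow (B : I → Finset κ) (owner : κ → κ → I) (home : κ → I)
    (A : Matrix κ κ ℝ) (r z : κ → ℝ) (i : I) (a : κ) : ℝ :=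
  ∑ b ∈ B i, (if owner a b = i then A a b * z b else 0) - if home a = i then r a else 0

variable {B : I → Finset κ} {owner : κ → κ → I} {home : κ → I}

theorem sat_nodeEquation {A : Matrix κ κ ℝ} {r z u : κ → ℝ} {i : I} {a : κ} (ha : a ∈ B i) :
    (nodeEquation owner home i a).Sat (B i) (A, r) z u ↔
      u a = nodeFlow B owner home A r z i a := by
  classical
  have h₁ : ∑ b ∈ B i, (nodeEquation owner home i a).state b (A, r) * z b =
      ∑ b ∈ B i, if owner a b = i then A a b * z b else 0 :=
    Finset.sum_congr rfl fun b _ => by simp only [nodeEquation]; split_ifs <;> simp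
  have h₂ : ∑ b ∈ B i, (nodeEquation owner home i a).flow b (A, r) * u b = -u a := by
    have : ∀ b, (nodeEquation owner home i a).flow b (A, r) * u b = if b = a then -u b else 0 :=
      fun b => by simp only [nodeEquation]; split_ifs <;> simp
    simp [this, ha]
  have h₃ : (nodeEquation owner home i a).rhs (A, r) = if home a = i then r a else 0 := by
    simp only [nodeEquation]; split_ifs <;> rfl
  rw [NodeRow.Sat, h₁, h₂, h₃, nodeFlow]
  constructor <;> intro h <;> linarith

theorem nodeFlow_eq_zero {A : Matrix κ κ ℝ}
    (howner : ∀ a b, A a b ≠ 0 → a ∈ B (owner a b) ∧ b ∈ B (owner a b))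
    (hhome : ∀ a, a ∈ B (home a)) {r z : κ → ℝ} {i : I} {a : κ} (ha : a ∉ B i) :
    nodeFlow B owner home A r z i a = 0 := by
  rw [nodeFlow, Finset.sum_eq_zero, if_neg, sub_zero]
  · rintro rfl
    exact ha (hhome a)
  · rintro b -
    split_ifs with h
    · subst h
      rw [not_not.1 fun h0 => ha (howner a b h0).1, zero_mul]
    · rfl

variable [Fintype κ] [Fintype I]

/-- Each entry has exactly one owner, so the shares add up to the residual. An entry whose owner's
bag misses the column index is zero and does no harm. -/
theorem sum_nodeFlow {A : Matrix κ κ ℝ}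
    (howner : ∀ a b, A a b ≠ 0 → a ∈ B (owner a b) ∧ b ∈ B (owner a b)) (r z : κ → ℝ) (a : κ) :
    ∑ i, nodeFlow B owner home A r z i a = A.mulVec z a - r a := by
  classical
  have h : ∀ i, ∑ b ∈ B i, (if owner a b = i then A a b * z b else 0) =
      ∑ b, if owner a b = i then A a b * z b else 0 := by
    intro i
    refine Finset.sum_subset (Finset.subset_univ _) fun b _ hb => ?_
    split_ifs with hi
    · subst hi
      rw [not_not.1 fun h0 => hb (howner a b h0).2, zero_mul]
    · rfl
  simp only [nodeFlow, h, Finset.sum_sub_distrib]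
  rw [Finset.sum_comm]
  simp [Matrix.mulVec, dotProduct]

/-- The distributed system is equivalent to the original one. -/
theorem treeSolution_nodeEquation_iff {A : Matrix κ κ ℝ}
    (howner : ∀ a b, A a b ≠ 0 → a ∈ B (owner a b) ∧ b ∈ B (owner a b))
    (hhome : ∀ a, a ∈ B (home a)) {r z : κ → ℝ} :
    (∃ u, TreeSolution B Finset.univ
      (fun i => (B i).toList.map (nodeEquation owner home i)) (A, r) z u) ↔ A.mulVec z = r := by
  constructor
  · rintro ⟨u, hu, hu0, hsum⟩
    funext a
    have : ∀ i, u i a = nodeFlow B owner home A r z i a := by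
      intro i
      by_cases ha : a ∈ B i
      · exact (sat_nodeEquation ha).1 (hu i (Finset.mem_univ i) _
          (List.mem_map_of_mem (Finset.mem_toList.2 ha)))
      · rw [hu0 i (Finset.mem_univ i) a ha, nodeFlow_eq_zero howner hhome ha]
    have h := hsum a
    rw [Finset.sum_congr rfl fun i _ => this i, sum_nodeFlow howner] at h
    linarith
  · rintro rfl
    refine ⟨nodeFlow B owner home A (A.mulVec z) z, fun i _ => ?_,
      fun i _ a ha => nodeFlow_eq_zero howner hhome ha,
      fun a => by rw [sum_nodeFlow howner, sub_self]⟩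
    rw [List.forall_mem_map]
    exact fun a ha => (sat_nodeEquation (Finset.mem_toList.1 ha)).2 rfl

/-- Linear systems whose matrix has the sparsity pattern of a tree decomposition are solved by a
computation tree of cost linear in the number of nodes and cubic in the size of the bags. -/
theorem exists_linearSolver [DecidableEq I] (hB : EliminationOrder B Finset.univ) {w : ℕ}
    (hw : ∀ i, (B i).card ≤ w) (hcover : ∀ a, ∃ i, a ∈ B i) :
    ∃ T : LinearSolver κ, T.cost ≤ Fintype.card I * (475 * w ^ 3) ∧
      ∀ (A : Matrix κ κ ℝ) (r : κ → ℝ), SparseOn B A → (∃ z, A.mulVec z = r) →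
        ∃ z, T.solve A r = some z ∧ A.mulVec z = r := by
  classical
  choose home hhome using hcover
  -- The assignment depends on the bags alone, not on the matrix, so that one computation tree
  -- serves all inputs. Pairs without a common bag get an arbitrary owner.
  have howner : ∀ a b, ∃ i, (∃ i, a ∈ B i ∧ b ∈ B i) → a ∈ B i ∧ b ∈ B i := fun a b => by
    by_cases h : ∃ i, a ∈ B i ∧ b ∈ B i
    · exact ⟨h.choose, fun _ => h.choose_spec⟩
    · exact ⟨home a, fun h' => absurd h' h⟩
  choose owner howner using howner
  let inp : Matrix κ κ ℝ × (κ → ℝ) → (κ × κ) ⊕ κ → ℝ :=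
    fun ω => Sum.elim (fun p => ω.1 p.1 p.2) ω.2
  -- The functions available at no cost: input entries and rational constants, which need no
  -- register.
  let K : Set (Matrix κ κ ℝ × (κ → ℝ) → ℝ) :=
    {f | ∃ o : Operand ((κ × κ) ⊕ κ), o.Below 0 ∧ ∀ ω, o.eval (inp ω) 0 = f ω}
  let X : Set (Matrix κ κ ℝ × (κ → ℝ)) := {ω | SparseOn B ω.1 ∧ ∃ z, ω.1.mulVec z = ω.2}
  have hconst : ∀ q : ℚ, (fun _ => (q : ℝ)) ∈ K := fun q => ⟨.const q, trivial, fun _ => rfl⟩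
  have h0 : (fun _ => 0) ∈ K := by simpa using hconst 0
  have h1 : (fun _ => 1) ∈ K := by simpa using hconst 1
  have h1' : (fun _ => -1) ∈ K := by simpa using hconst (-1)
  have hiff : ∀ ω ∈ X, ∀ z, (∃ u, TreeSolution B Finset.univ
      (fun i => (B i).toList.map (nodeEquation owner home i)) ω z u) ↔ ω.1.mulVec z = ω.2 :=
    fun ω hω z => treeSolution_nodeEquation_iff (fun a b hab => howner a b (hω.1 a b hab)) hhome
  have hsolve := Comp.solve_tree (X := X) (K := K) hB hw
    (L := fun i => (B i).toList.map (nodeEquation owner home i))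
    (fun i _ => by simp only [List.length_map, Finset.length_toList]; omega)
    (fun i _ => by
      rw [List.forall_mem_map]
      refine fun a _ => ⟨fun b _ => ⟨?_, ?_⟩, ?_⟩
      · simp only [nodeEquation]
        split_ifs
        · exact ⟨.input (.inl (a, b)), trivial, fun _ => rfl⟩
        · exact h0
      · simp only [nodeEquation]
        split_ifs
        · exact h1'
        · exact h0
      · simp only [nodeEquation]
        split_ifs
        · exact ⟨.input (.inr a), trivial, fun _ => rfl⟩
        · exact h0)
    h0 h1 h1' fun ω hω => by
      obtain ⟨z, hz⟩ := hω.2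
      exact ⟨z, (hiff ω hω z).2 hz⟩
  obtain ⟨T, hT, hrun⟩ := Comp.exists_computationTree
    (P := fun ω z => ω ∈ X → ω.1.mulVec z = ω.2) inp
    (hsolve.weaken fun X' K' hX' _ h => by
      obtain ⟨z, u, hz, -, hu⟩ := h
      exact ⟨z, hz, fun ω hω hωX => (hiff ω hωX _).1 ⟨_, hu ω hω⟩⟩)
    (fun _ => 0) 0 fun f hf => by
      obtain ⟨o, ho, hof⟩ := hf
      exact ⟨o, ho, fun ω _ => hof ω⟩
  refine ⟨T, by simpa using hT, fun A r hA hr => ?_⟩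
  obtain ⟨z, hz, hzX⟩ := hrun (A, r) ⟨hA, hr⟩
  exact ⟨z, hz, hzX ⟨hA, hr⟩⟩

end Solver

/-! ### The sparsity pattern of the KKT matrix -/

namespace ComputationalStructure

variable {V : Type*} [Fintype V] {n : V → ℕ} {F : Type*} [NormedAddCommGroup F] [NormedSpace ℝ F]

theorem contDiffAt_eval (v : V) {x : State n} : ContDiffAt ℝ 2 (fun x : State n => x v) x :=
  (ContinuousLinearMap.proj (R := ℝ) (φ := fun v => Fin (n v) → ℝ) v).contDiff.contDiffAt

/-- If `y` and `y'` agree on `s`, then `g` is invariant under translation by `y' - y`, and so is its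
derivative; no differentiability is needed. -/
theorem dependsOn_fderiv {g : State n → F} {s : Set V} (hg : DependsOn g s) :
    DependsOn (fderiv ℝ g) s := by
  intro y y' h
  have : g = fun x => g (x + (y' - y)) := by
    funext x
    refine hg fun v hv => ?_
    simp [h v hv]
  conv_lhs => rw [this]
  rw [fderiv_comp_add_right, add_sub_cancel]

variable [DecidableEq V]

/-- Along the direction of `b` the function is constant. Where it is not differentiable, `fderiv` is
zero by convention, so the identity holds at every point. -/
theorem fderiv_unitVector_eq_zero {g : State n → F} {s : Set V} (hg : DependsOn g s)
    {b : PrimalIndex n} (hb : b.1 ∉ s) (x : State n) : fderiv ℝ g x (unitVector b) = 0 := by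
  by_cases hd : DifferentiableAt ℝ g x
  · rw [← hd.lineDeriv_eq_fderiv, lineDeriv]
    have : (fun t : ℝ => g (x + t • unitVector b)) = fun _ => g x := by
      funext t
      refine hg fun v hv => ?_
      have hvb : v ≠ b.1 := ne_of_mem_of_not_mem hv hb
      simp [unitVector, hvb]
    rw [this, deriv_const]
  · rw [fderiv_zero_of_not_differentiableAt hd, zero_apply]

/-- In each term one of the two derivatives vanishes: either the term, hence also its derivative,
does not depend on `a`, or its derivative in the direction of `b` is identically zero. -/
theorem fderiv_fderiv_sum_eq_zero {ι : Type*} [Fintype ι] {q : ι → State n → ℝ} {s : ι → Set V}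
    (hq : ∀ i, DependsOn (q i) (s i)) {x : State n} (hc : ∀ i, ContDiffAt ℝ 2 (q i) x)
    {a b : PrimalIndex n} (hab : ∀ i, a.1 ∈ s i → b.1 ∉ s i) :
    fderiv ℝ (fderiv ℝ fun y => ∑ i, q i y) x (unitVector a) (unitVector b) = 0 := by
  -- The terms are smooth only near `x`, so the sum rule holds on a neighbourhood; this is enough
  -- for the second derivative at `x`.
  have hev : (fderiv ℝ fun y => ∑ i, q i y) =ᶠ[nhds x] fun y => ∑ i, fderiv ℝ (q i) y := by
    have : ∀ᶠ y in nhds x, ∀ i, DifferentiableAt ℝ (q i) y := by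
      rw [Filter.eventually_all]
      exact fun i => ((hc i).eventually (by simp)).mono fun y hy =>
        hy.differentiableAt (by norm_num)
    exact this.mono fun y hy => fderiv_fun_sum fun i _ => hy i
  have hd : ∀ i, DifferentiableAt ℝ (fderiv ℝ (q i)) x := fun i =>
    ((hc i).fderiv_right (m := 1) (by norm_num)).differentiableAt (by norm_num)
  rw [hev.fderiv_eq, fderiv_fun_sum fun i _ => hd i]
  simp only [sum_apply]
  refine Finset.sum_eq_zero fun i _ => ?_
  by_cases ha : a.1 ∈ s i
  · have h := fderiv_clm_apply (hd i) (differentiableAt_const (unitVector b))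
    have h0 : (fun y => fderiv ℝ (q i) y (unitVector b)) = fun _ => 0 :=
      funext fun y => fderiv_unitVector_eq_zero (hq i) (hab i ha) y
    rw [h0] at h
    have := congrArg (fun f => f (unitVector a)) h
    simpa using this.symm
  · rw [fderiv_unitVector_eq_zero (dependsOn_fderiv (hq i)) ha, zero_apply]

variable {G : Digraph V} (S : ComputationalStructure G n)

theorem dependsOn_constraint (v : NonInput G) :
    DependsOn (S.constraint v) (closedParents G v : Set V) := by
  intro y y' h
  have h' : (fun z : ↥(parents G v) => y z) = fun z : ↥(parents G v) => y' z :=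
    funext fun z => h z (Finset.mem_insert_of_mem z.2)
  rw [constraint, constraint, h', h v (Finset.mem_insert_self _ _)]

theorem dependsOn_l (v : V) :
    DependsOn (fun x : State n => S.l v fun z => x z) (closedParents G v : Set V) := by
  intro y y' h
  exact congrArg (S.l v) (funext fun z => h z z.2)

theorem contDiffAt_l {x : State n} (hx : ∀ v, x v ∈ S.dom v) (v : V) :
    ContDiffAt ℝ 2 (fun x : State n => S.l v fun z => x z) x := by
  have hmem : (fun z : ↥(closedParents G v) => x z) ∈
      Set.univ.pi fun z : ↥(closedParents G v) => S.dom z :=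
    fun z _ => hx z
  have h : ContDiffAt ℝ 2 (S.l v) fun z => x z :=
    (S.contDiffOn_l v).contDiffAt ((isOpen_set_pi Set.finite_univ
      fun (z : ↥(closedParents G v)) _ => S.isOpen_dom z).mem_nhds hmem)
  exact h.comp x (contDiffAt_pi.2 fun z => contDiffAt_eval z.1)

theorem contDiffAt_constraint {x : State n} (hx : ∀ v, x v ∈ S.dom v) (v : NonInput G) :
    ContDiffAt ℝ 2 (S.constraint v) x := by
  have hmem : (fun z : ↥(parents G v) => x z) ∈ Set.univ.pi fun z : ↥(parents G v) => S.dom z :=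
    fun z _ => hx z
  have h : ContDiffAt ℝ 2 (S.Φ v) fun z => x z :=
    (S.contDiffOn_Φ v).contDiffAt ((isOpen_set_pi Set.finite_univ
      fun (z : ↥(parents G v)) _ => S.isOpen_dom z).mem_nhds hmem)
  exact (h.comp x (contDiffAt_pi.2 fun z => contDiffAt_eval z.1)).sub
    (contDiffAt_eval v.1)

/-- The vertex to which a scalar unknown belongs. -/
def vertex : KKTIndex G n → V :=
  Sum.elim Sigma.fst fun c => c.1.1

theorem lagrangianHessian_eq_zero {x : State n} (hx : ∀ v, x v ∈ S.dom v)
    (lam : ∀ v : NonInput G, Fin (n v) → ℝ) {a b : PrimalIndex n}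
    (hab : ∀ v, a.1 ∈ closedParents G v → b.1 ∉ closedParents G v) :
    S.lagrangianHessian lam x a b = 0 := by
  let q : V ⊕ NonInput G → State n → ℝ :=
    Sum.elim (fun v x => S.l v fun z => x z) fun v x => lam v ⬝ᵥ S.constraint v x
  have hq : S.lagrangian lam = fun y => ∑ i, q i y := by
    funext y
    simp [lagrangian, objective, q, Fintype.sum_sum_type]
  rw [lagrangianHessian, Matrix.of_apply, hq]
  refine fderiv_fderiv_sum_eq_zero
    (s := Sum.elim (fun v => (closedParents G v : Set V)) fun v => (closedParents G v.1 : Set V))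
    ?_ ?_ ?_
  · rintro (v | v)
    · exact S.dependsOn_l v
    · exact fun y y' h => congrArg (lam v ⬝ᵥ ·) (S.dependsOn_constraint v h)
  · rintro (v | v)
    · exact S.contDiffAt_l hx v
    · have h : ContDiffAt ℝ 2 (fun y => ∑ k, lam v k * S.constraint v y k) x :=
        ContDiffAt.sum fun k _ => contDiffAt_const.mul
          (contDiffAt_pi.1 (S.contDiffAt_constraint hx v) k)
      exact h
  · rintro (v | v)
    · exact hab v
    · exact hab v

theorem constraintJacobian_eq_zero {x : State n} {c : DualIndex G n} {b : PrimalIndex n}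
    (hb : b.1 ∉ closedParents G c.1) : S.constraintJacobian x c b = 0 := by
  rw [constraintJacobian, Matrix.of_apply,
    fderiv_unitVector_eq_zero (S.dependsOn_constraint c.1) hb, Pi.zero_apply]

theorem exists_of_kktMatrix_ne_zero {x : State n} (hx : ∀ v, x v ∈ S.dom v)
    (lam : ∀ v : NonInput G, Fin (n v) → ℝ) {a b : KKTIndex G n}
    (hab : S.kktMatrix lam x a b ≠ 0) :
    ∃ v, vertex a ∈ closedParents G v ∧ vertex b ∈ closedParents G v := by
  by_contra! h
  apply hab
  rcases a with a | a <;> rcases b with b | b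
  · exact S.lagrangianHessian_eq_zero hx lam h
  -- The constraint at `v` involves only `v` and its parents, and its multiplier is placed at `v`,
  -- so the hyperedge of `v` contains both indices of a nonzero Jacobian entry.
  · exact S.constraintJacobian_eq_zero fun ha => h b.1 ha (Finset.mem_insert_self _ _)
  · exact S.constraintJacobian_eq_zero (h a.1 (Finset.mem_insert_self _ _))
  · rfl

end ComputationalStructure

/-! ### The bags of scalar unknowns -/

namespace TreeDecomposition

variable {V I : Type*} [Fintype V] [DecidableEq V] {G : Digraph V}
  (D : TreeDecomposition (hyperedges G) I) (n : V → ℕ)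

/-- The unknowns of the KKT system that belong to the vertices in a bag. -/
noncomputable def kktBag (i : I) : Finset (KKTIndex G n) :=
  Finset.univ.filter fun a => ComputationalStructure.vertex a ∈ D.bag i

theorem mem_kktBag {i : I} {a : KKTIndex G n} :
    a ∈ D.kktBag n i ↔ ComputationalStructure.vertex a ∈ D.bag i := by
  simp [kktBag]

variable [Fintype I]

/-- A scalar coordinate contributes itself and at most one multiplier. -/
theorem card_kktBag_le (i : I) : (D.kktBag n i).card ≤ 2 * D.scalarBagSize n := by
  let f : KKTIndex G n → Bool × PrimalIndex n :=
    Sum.elim (fun a => (false, a)) fun c => (true, ⟨c.1.1, c.2⟩)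
  have hmaps : ∀ a ∈ D.kktBag n i, f a ∈ (Finset.univ : Finset Bool) ×ˢ
      ((D.bag i).sigma fun v => (Finset.univ : Finset (Fin (n v)))) := by
    rintro (a | c) h <;> rw [mem_kktBag] at h <;>
      simpa [f, ComputationalStructure.vertex, Finset.mem_sigma] using h
  have hinj : Set.InjOn f (D.kktBag n i) := by
    rintro (a | ⟨⟨v, hv⟩, k⟩) - (b | ⟨⟨w, hw⟩, l⟩) - h
    · simpa [f] using h
    · simp [f] at h
    · simp [f] at h
    · simp only [f, Sum.elim_inr, Prod.mk.injEq, true_and, Sigma.mk.injEq] at h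
      obtain ⟨rfl, h⟩ := h
      rw [eq_of_heq h]
  refine (Finset.card_le_card_of_injOn f hmaps hinj).trans ?_
  rw [Finset.card_product, Finset.card_sigma, Finset.card_univ, Fintype.card_bool]
  simp only [Finset.card_univ, Fintype.card_fin]
  gcongr
  exact Finset.le_sup (f := fun i => ∑ v ∈ D.bag i, n v) (Finset.mem_univ i)

theorem scalarBagSize_le : D.scalarBagSize n ≤ Finset.univ.sup n * (D.width + 1) := by
  refine Finset.sup_le fun i _ => ?_
  have hcard : (D.bag i).card ≤ D.width + 1 := by
    have := Finset.le_sup (f := fun i => (D.bag i).card) (Finset.mem_univ i)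
    simp only [width]
    omega
  calc ∑ v ∈ D.bag i, n v ≤ (D.bag i).card * Finset.univ.sup n := by
        simpa using Finset.sum_le_card_nsmul (D.bag i) n _
          fun v _ => Finset.le_sup (Finset.mem_univ v)
    _ ≤ Finset.univ.sup n * (D.width + 1) := by
        rw [mul_comm]
        gcongr

end TreeDecomposition

/-! ### The KKT system -/

theorem theorem2 :
    ∃ C : ℕ, ∀ (V : Type*) [Fintype V] [DecidableEq V] (I : Type*) [Fintype I]
      (G : Digraph V) (_ : IsDAG G) (n : V → ℕ) (D : TreeDecomposition (hyperedges G) I),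
      ∃ T : LinearSolver (KKTIndex G n),
        T.cost ≤ C * D.size * D.scalarBagSize n ^ 3 ∧
        T.cost ≤ C * D.size * (Finset.univ.sup n * (D.width + 1)) ^ 3 ∧
        ∀ (S : ComputationalStructure G n) (x : State n)
          (lam : ∀ v : NonInput G, Fin (n v) → ℝ),
          (∀ v, x v ∈ S.dom v) →
          (∃ z, (S.kktMatrix lam x).mulVec z = S.kktRHS x) →
          ∃ z, T.solve (S.kktMatrix lam x) (S.kktRHS x) = some z ∧
            (S.kktMatrix lam x).mulVec z = S.kktRHS x := by
  classical
  -- Here `3800 = 475 * 2 ^ 3`, because multipliers at most double the size of a bag.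
  refine ⟨3800, fun V _ _ I _ G _ n D => ?_⟩
  have horder : EliminationOrder (D.kktBag n) Finset.univ :=
    D.isTree.eliminationOrder fun a => by
      have h : {i | a ∈ D.kktBag n i} = {i | ComputationalStructure.vertex a ∈ D.bag i} :=
        Set.ext fun i => D.mem_kktBag n
      rw [h]
      exact (D.subtree (ComputationalStructure.vertex a)).connected.preconnected
  obtain ⟨T, hT, hsolve⟩ := exists_linearSolver horder (D.card_kktBag_le n) fun a => by
    simpa only [D.mem_kktBag] using D.vertex_cover (ComputationalStructure.vertex a)
  have hcost : T.cost ≤ 3800 * D.size * D.scalarBagSize n ^ 3 :=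
    hT.trans_eq (by rw [TreeDecomposition.size]; ring)
  refine ⟨T, hcost, hcost.trans ?_, fun S x lam hx hz => hsolve _ _ (fun a b hab => ?_) hz⟩
  · gcongr
    exact D.scalarBagSize_le n
  · obtain ⟨v, ha, hb⟩ := S.exists_of_kktMatrix_ne_zero hx lam hab
    obtain ⟨i, hi⟩ := D.edge_cover _ ⟨v, rfl⟩
    exact ⟨i, (D.mem_kktBag n).2 (hi ha), (D.mem_kktBag n).2 (hi hb)⟩
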